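/- Let $n,m\ge 1$ and let $f=(f_1,\dots,f_m):\mathbb R^n\to\mathbb R^m$ be a polynomial map, $f_i(x)=\sum_{\alpha\in\mathbb Z_{\ge 0}^n}a^i_\alpha x^\alpha$. Let $\Gamma(f)\subset\mathbb R^n$ be the convex hull of $\bigcup_{i=1}^m\{\alpha: a^i_\alpha\ne 0\}$ (the Newton polyhedron of $f$). For a nonempty face $\Delta$ of $\Gamma(f)$ (the whole of $\Gamma(f)$ being allowed) put $f_{i,\Delta}(x)=\sum_{\alpha\in\Delta}a^i_\alpha x^\alpha$. Assume that $f$ satisfies the Mikhailov–Gindikin condition: for every nonempty face $\Delta$ of $\Gamma(f)$ and every $x\in(\mathbb R\setminus\{0\})^n$ one has $\max_{1\le i\le m}|f_{i,\Delta}(x)|\ne 0$. For $r>0$ let $G^f(r)=\{x\in\mathbb R^n: |f_i(x)|\le r,\ i=1,\dots,m\}$, let $|G^f(r)|$ denote its Lebesgue measure, and let $\operatorname{cone}\Gamma(f)=\{\lambda x:\lambda\ge 0,\ x\in\Gamma(f)\}$. Then: (i) $|G^f(r)|<\infty$ for all $r>0$ if and only if $(1,\dots,1)$ belongs to the interior of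 $\operatorname{cone}\Gamma(f)$ in $\mathbb R^n$. (ii) Suppose that $|G^f(r)|<\infty$ for all $r>0$. Then there is a largest $d_\infty>0$ with $(d_\infty,\dots,d_\infty)\in\Gamma(f)$, and there is a face of $\Gamma(f)$ containing $(d_\infty,\dots,d_\infty)$ in its relative interior. Let $k$ be the smallest dimension of such a face, and put $\theta=1/d_\infty$. Then $$|G^f(r)|\asymp r^{\theta}(\ln r)^{n-k-1}\quad\text{as } r\to\infty,$$ that is, there are constants $K_1,K_2>0$, possibly depending on $f$, such that $K_1r^{\theta}(\ln r)^{n-k-1}\le|G^f(r)|\le K_2r^{\theta}(\ln r)^{n-k-1}$ for all sufficiently large $r$. -/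

import Mathlib

open MeasureTheory Filter

noncomputable section

namespace NewtonVolume

/-- The exponent `α ∈ ℕⁿ` of a monomial, seen as a point of `ℝⁿ`. -/
def expPoint {n : ℕ} (α : Fin n →₀ ℕ) : Fin n → ℝ := fun j => (α j : ℝ)

/-- The Newton polyhedron `Γ(f)`: the convex hull of the union of the supports of the `f i`. -/
def newtonPolyhedron {n m : ℕ} (f : Fin m → MvPolynomial (Fin n) ℝ) : Set (Fin n → ℝ) :=
  convexHull ℝ (⋃ i, expPoint '' ((f i).support : Set (Fin n →₀ ℕ)))

/-- Faces of a convex polytope `P`: the nonempty sets on which some linear form attains its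
maximum over `P`. The zero form gives `P` itself, so `P` is a face of itself when nonempty. -/
def IsFace {n : ℕ} (P F : Set (Fin n → ℝ)) : Prop :=
  F.Nonempty ∧ IsExposed ℝ P F

/-- Dimension of a set: the dimension of its affine hull. -/
def affDim {n : ℕ} (F : Set (Fin n → ℝ)) : ℕ := Module.finrank ℝ (vectorSpan ℝ F)

open Classical in
/-- The part `p_Δ = ∑_{α ∈ Δ} a_α x^α` of a polynomial `p = ∑ a_α x^α`. -/
def facePart {n : ℕ} (p : MvPolynomial (Fin n) ℝ) (Δ : Set (Fin n → ℝ)) :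
    MvPolynomial (Fin n) ℝ :=
  ∑ α ∈ p.support.filter (fun α => expPoint α ∈ Δ), MvPolynomial.monomial α (p.coeff α)

/-- The Mikhailov–Gindikin condition: for each face `Δ` of `Γ(f)`, `max_i |f_{i,Δ}(x)| ≠ 0`
(that is, some `f_{i,Δ}(x)` is nonzero) at each `x` with all coordinates nonzero. -/
def MikhailovGindikin {n m : ℕ} (f : Fin m → MvPolynomial (Fin n) ℝ) : Prop :=
  ∀ Δ : Set (Fin n → ℝ), IsFace (newtonPolyhedron f) Δ →
    ∀ x : Fin n → ℝ, (∀ j, x j ≠ 0) → ∃ i, MvPolynomial.eval x (facePart (f i) Δ) ≠ 0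

/-- The sublevel set `G^f(r)`. -/
def sublevel {n m : ℕ} (f : Fin m → MvPolynomial (Fin n) ℝ) (r : ℝ) : Set (Fin n → ℝ) :=
  {x | ∀ i, |MvPolynomial.eval x (f i)| ≤ r}

/-- The cone generated by a set. -/
def coneOf {n : ℕ} (P : Set (Fin n → ℝ)) : Set (Fin n → ℝ) :=
  {y | ∃ c : ℝ, 0 ≤ c ∧ ∃ x ∈ P, y = c • x}

/-- The point `(d, …, d)` of the diagonal. -/
def diag (n : ℕ) (d : ℝ) : Fin n → ℝ := fun _ => d

/-- `(d, …, d)` is the point of `P` on the diagonal of the positive orthant that is farthest from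
the origin. -/
def IsFarthestDiag {n : ℕ} (P : Set (Fin n → ℝ)) (d : ℝ) : Prop :=
  IsGreatest {t : ℝ | 0 < t ∧ diag n t ∈ P} d

/-- `F` is a face of `P` of smallest dimension among those having `z` in their (relative)
interior. -/
def IsSmallestFaceAt {n : ℕ} (P : Set (Fin n → ℝ)) (z : Fin n → ℝ) (F : Set (Fin n → ℝ)) : Prop :=
  (IsFace P F ∧ z ∈ intrinsicInterior ℝ F) ∧
    ∀ F', IsFace P F' → z ∈ intrinsicInterior ℝ F' → affDim F ≤ affDim F'

/-- `g ≍ h` as `r → ∞`. -/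
def AsympAtTop (g h : ℝ → ℝ) : Prop :=
  ∃ K₁ K₂ : ℝ, 0 < K₁ ∧ 0 < K₂ ∧ ∀ᶠ r in atTop, K₁ * h r ≤ g r ∧ g r ≤ K₂ * h r

end NewtonVolume

end

/-!
The proof passes to logarithmic coordinates. Let `A` be the finite set of exponents of `f`, so that
`Γ(f) = conv A`.

*Reduction to monomials.* The Mikhailov–Gindikin condition implies that, off the coordinate
hyperplanes, `max_i |f_i(x)|` is comparable to `max_{α ∈ A} |x^α|`
(`MikhailovGindikin.exists_le_abs_eval`; the upper bound is trivial). Otherwise some sequence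
`x_k = σ exp(ξ_k)` makes all `f_i(x_k)` negligible with respect to the monomials; a limit of the
normalized vectors `(|x_k^α|)_α` is supported on the exponents of one face `Δ` and is proportional
there to the vector of monomials of a genuine point `σ exp(ζ)` (`exists_face_of_tendsto`), so all
`f_{i,Δ}` vanish at that point. Substituting `x = σ exp(ξ)` in each orthant bounds `|G^f(r)|` on both
sides by values of `V(R) = ∫ exp(ξ_1 + ⋯ + ξ_n) dξ` over `{ξ | ⟨α, ξ⟩ ≤ R for all α ∈ A}`, with
`R = ln r + O(1)`.

*Finiteness.* If `(1, …, 1)` is not interior to the cone, Farkas' lemma and compactness of the sphere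
give `η ≠ 0` with `⟨α, η⟩ ≤ 0` on `A` and `∑ η_j ≥ 0`. The region contains disjoint translates of a
ball along `η` whose contributions are bounded below, so `V(R) = ∞` (`logVolume_eq_top`).

*Asymptotics.* The maximum of `∑ ξ_j` over `{ξ | ⟨α, ξ⟩ ≤ 1 for all α ∈ A}` is `θ = 1 / d`, by linear
programming duality. Strict complementarity (`exists_strictly_complementary`) yields an optimal `ξ₀`
such that `(d, …, d)` is a convex combination with positive weights of exactly those `α ∈ A` with
`⟨α, ξ₀⟩ = 1`. Hence these active exponents span the smallest face at `(d, …, d)`, and their linear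
span has dimension `k + 1`, since the face lies in an affine hyperplane that misses the origin. Write
`ξ = R ξ₀ + ζ` and take the pairings `y_i` of `ζ` with a basis of `ℝⁿ` whose first `k + 1` vectors are
active exponents. The integrand is `exp(R θ)` times a function that decays in the first `k + 1`
coordinates and does not depend on the other `n - k - 1`, while the latter range over an interval of
length of order `R`. This gives `V(R) ≍ exp(R θ) R^(n - k - 1)`
(`IsComplementaryPair.exists_logVolume_le` and `IsComplementaryPair.exists_le_logVolume`).
-/

namespace NewtonVolume

open Topology

variable {n m : ℕ}

/-! ### Farkas' lemma and cones over polytopes -/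

/-- **Farkas' lemma** for finitely many generators in an arbitrary real vector space. The induction
step projects along the new generator onto the kernel of a form separating `b` from the others. -/
theorem exists_nonneg_combination {E ι : Type*} [AddCommGroup E] [Module ℝ E] [DecidableEq ι]
    (s : Finset ι) (a : ι → E) (b : E)
    (h : ∀ φ : E →ₗ[ℝ] ℝ, (∀ i ∈ s, 0 ≤ φ (a i)) → 0 ≤ φ b) :
    ∃ μ : ι → ℝ, (∀ i, 0 ≤ μ i) ∧ b = ∑ i ∈ s, μ i • a i := by
  induction s using Finset.induction_on generalizing a b with
  | empty =>
    refine ⟨0, fun _ => le_rfl, ?_⟩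
    rw [Finset.sum_empty, ← Module.forall_dual_apply_eq_zero_iff ℝ b]
    intro φ
    have h1 := h φ (by simp)
    have h2 := h (-φ) (by simp)
    simp only [LinearMap.neg_apply] at h2
    linarith
  | insert j s hj ih =>
    by_cases hb : ∃ μ : ι → ℝ, (∀ i, 0 ≤ μ i) ∧ b = ∑ i ∈ s, μ i • a i
    · obtain ⟨μ, hμ, rfl⟩ := hb
      refine ⟨Function.update μ j 0, fun i => ?_, ?_⟩
      · by_cases hi : i = j
        · subst hi; simp
        · simp [hi, hμ]
      · rw [Finset.sum_insert hj]
        simp only [Function.update_self, zero_smul, zero_add]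
        exact Finset.sum_congr rfl fun i hi => by
          rw [Function.update_of_ne (ne_of_mem_of_not_mem hi hj)]
    · obtain ⟨φ, hφ, hφb⟩ : ∃ φ : E →ₗ[ℝ] ℝ, (∀ i ∈ s, 0 ≤ φ (a i)) ∧ φ b < 0 := by
        by_contra hcon
        push Not at hcon
        exact hb (ih a b hcon)
      have hφj : φ (a j) < 0 := by
        by_contra hcon
        push Not at hcon
        have := h φ (by
          intro i hi
          rcases Finset.mem_insert.1 hi with rfl | hi
          · exact hcon
          · exact hφ i hi)
        linarith
      obtain ⟨μ, hμ, hbμ⟩ := ih (fun i => a i - (φ (a i) / φ (a j)) • a j)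
        (b - (φ b / φ (a j)) • a j) (by
          intro ψ hψ
          have := h (ψ - (ψ (a j) / φ (a j)) • φ) (by
            intro i hi
            rcases Finset.mem_insert.1 hi with rfl | hi
            · simp [hφj.ne]
            · have := hψ i hi
              simp only [map_sub, map_smul, smul_eq_mul, LinearMap.sub_apply,
                LinearMap.smul_apply] at this ⊢
              calc _ ≤ _ := this
                _ = _ := by ring)
          simp only [map_sub, map_smul, smul_eq_mul, LinearMap.sub_apply,
            LinearMap.smul_apply] at this ⊢
          calc _ ≤ _ := this
            _ = _ := by ring)
      set c : ℝ := φ b / φ (a j) + ∑ i ∈ s, μ i * (-(φ (a i) / φ (a j))) with hc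
      have hc0 : 0 ≤ c := by
        refine add_nonneg (div_nonneg_of_nonpos hφb.le hφj.le) (Finset.sum_nonneg fun i hi => ?_)
        refine mul_nonneg (hμ i) ?_
        rw [← div_neg]
        exact div_nonneg (hφ i hi) (by linarith)
      refine ⟨Function.update μ j c, fun i => ?_, ?_⟩
      · by_cases hi : i = j
        · subst hi; simpa using hc0
        · simp [hi, hμ]
      · rw [Finset.sum_insert hj, Function.update_self]
        have h1 : ∑ i ∈ s, Function.update μ j c i • a i = ∑ i ∈ s, μ i • a i :=
          Finset.sum_congr rfl fun i hi => by
            rw [Function.update_of_ne (ne_of_mem_of_not_mem hi hj)]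
        have h2 : b = (φ b / φ (a j)) • a j +
            ∑ i ∈ s, μ i • (a i - (φ (a i) / φ (a j)) • a j) := by
          rw [← hbμ]; abel
        rw [h1, h2, hc, add_smul, Finset.sum_smul, add_assoc, ← Finset.sum_add_distrib]
        congr 1
        refine Finset.sum_congr rfl fun i _ => ?_
        rw [smul_sub, smul_smul, mul_neg, neg_smul]
        abel

theorem exists_dotProduct_eq {n : ℕ} (φ : (Fin n → ℝ) →ₗ[ℝ] ℝ) :
    ∃ ξ : Fin n → ℝ, ∀ x, φ x = x ⬝ᵥ ξ := by
  refine ⟨fun j => φ (Pi.single j 1), fun x => ?_⟩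
  conv_lhs => rw [pi_eq_sum_univ' x]
  simp [dotProduct]

theorem sum_smul_dotProduct (A : Finset (Fin n → ℝ)) (μ : (Fin n → ℝ) → ℝ) (ξ : Fin n → ℝ) :
    (∑ α ∈ A, μ α • α) ⬝ᵥ ξ = ∑ α ∈ A, μ α * (α ⬝ᵥ ξ) := by
  rw [sum_dotProduct]
  simp [smul_dotProduct]

theorem isExposed_setOf_dotProduct_le (P : Set (Fin n → ℝ)) (ξ : Fin n → ℝ) :
    IsExposed ℝ P {x ∈ P | ∀ y ∈ P, y ⬝ᵥ ξ ≤ x ⬝ᵥ ξ} := by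
  let l : (Fin n → ℝ) →ₗ[ℝ] ℝ :=
    { toFun := fun x => x ⬝ᵥ ξ
      map_add' := fun x y => add_dotProduct x y ξ
      map_smul' := fun c x => smul_dotProduct c x ξ }
  exact fun _ => ⟨LinearMap.toContinuousLinearMap l, rfl⟩

theorem mem_coneOf_convexHull {A : Finset (Fin n → ℝ)} (hA : A.Nonempty) {v : Fin n → ℝ} :
    v ∈ coneOf (convexHull ℝ (A : Set (Fin n → ℝ))) ↔
      ∃ μ : (Fin n → ℝ) → ℝ, (∀ α, 0 ≤ μ α) ∧ v = ∑ α ∈ A, μ α • α := by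
  classical
  constructor
  · rintro ⟨c, hc, x, hx, rfl⟩
    obtain ⟨w, hw0, -, hwx⟩ := Finset.mem_convexHull'.1 hx
    refine ⟨fun α => if α ∈ A then c * w α else 0, fun α => ?_, ?_⟩
    · dsimp only
      split_ifs with h
      · exact mul_nonneg hc (hw0 α h)
      · exact le_rfl
    · rw [← hwx, Finset.smul_sum]
      exact Finset.sum_congr rfl fun α hα => by simp only [if_pos hα, smul_smul]
  · rintro ⟨μ, hμ, rfl⟩
    rcases (Finset.sum_nonneg fun α (_ : α ∈ A) => hμ α).eq_or_lt with h0 | hpos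
    · obtain ⟨α, hα⟩ := hA
      refine ⟨0, le_rfl, α, subset_convexHull ℝ _ hα, ?_⟩
      rw [zero_smul]
      refine Finset.sum_eq_zero fun β hβ => ?_
      rw [(Finset.sum_eq_zero_iff_of_nonneg fun α _ => hμ α).1 h0.symm β hβ, zero_smul]
    · refine ⟨∑ α ∈ A, μ α, hpos.le, (∑ α ∈ A, μ α)⁻¹ • ∑ α ∈ A, μ α • α, ?_, ?_⟩
      · rw [Finset.mem_convexHull']
        refine ⟨fun α => (∑ α ∈ A, μ α)⁻¹ * μ α, fun α _ => mul_nonneg (inv_nonneg.2 hpos.le) (hμ α),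
          ?_, ?_⟩
        · rw [← Finset.mul_sum, inv_mul_cancel₀ hpos.ne']
        · simp only [Finset.smul_sum, smul_smul]
      · rw [smul_smul, mul_inv_cancel₀ hpos.ne', one_smul]

theorem diag_dotProduct (d : ℝ) (ξ : Fin n → ℝ) : diag n d ⬝ᵥ ξ = d * ∑ j, ξ j := by
  simp [diag, dotProduct, Finset.mul_sum]

/-- If `(1, …, 1)` is not interior to the cone over a polytope, some closed half-space whose boundary
hyperplane passes through the origin contains the cone and does not have `(1, …, 1)` in its interior.
Otherwise the forms `η` that are nonpositive on `A` are uniformly negative at `(1, …, 1)`, hence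
nonpositive near it, and Farkas' lemma puts a neighbourhood of it in the cone. -/
theorem exists_recession_of_notMem_interior {A : Finset (Fin n → ℝ)} (hA : A.Nonempty)
    (h : diag n 1 ∉ interior (coneOf (convexHull ℝ (A : Set (Fin n → ℝ))))) :
    ∃ η : Fin n → ℝ, η ≠ 0 ∧ (∀ α ∈ A, α ⬝ᵥ η ≤ 0) ∧ 0 ≤ ∑ j, η j := by
  classical
  by_contra hcon
  push Not at hcon
  apply h
  have hcont : ∀ α : Fin n → ℝ, Continuous fun η : Fin n → ℝ => α ⬝ᵥ η := fun α => by
    unfold dotProduct; fun_prop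
  set K : Set (Fin n → ℝ) := Metric.sphere 0 1 ∩ ⋂ α ∈ A, {η | α ⬝ᵥ η ≤ 0} with hK
  have hKc : IsCompact K := (isCompact_sphere _ _).inter_right
    (isClosed_biInter fun α _ => isClosed_le (hcont α) continuous_const)
  have hKmem : ∀ η ∈ K, η ≠ 0 ∧ (∀ α ∈ A, α ⬝ᵥ η ≤ 0) ∧ ‖η‖ = 1 := by
    rintro η ⟨h1, h2⟩
    have h1' : ‖η‖ = 1 := by simpa using h1
    refine ⟨?_, fun α hα => ?_, h1'⟩
    · rintro rfl; simp at h1'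
    · simp only [Set.mem_iInter] at h2; exact h2 α hα
  obtain ⟨c, hc, hcK⟩ : ∃ c : ℝ, 0 < c ∧ ∀ η ∈ K, ∑ j, η j ≤ -c := by
    rcases K.eq_empty_or_nonempty with hE | hne
    · exact ⟨1, one_pos, by simp [hE]⟩
    · obtain ⟨η₀, hη₀, hmax⟩ := hKc.exists_isMaxOn hne
        (f := fun η : Fin n → ℝ => ∑ j, η j) (by fun_prop)
      have := hcon η₀ (hKmem _ hη₀).1 (hKmem _ hη₀).2.1
      exact ⟨-∑ j, η₀ j, by linarith, fun η hη => by simpa using hmax hη⟩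
  have hε : 0 < c / (n + 1) := by positivity
  rw [mem_interior]
  refine ⟨Metric.ball (diag n 1) (c / (n + 1)), fun v hv => ?_, Metric.isOpen_ball,
    Metric.mem_ball_self hε⟩
  rw [mem_coneOf_convexHull hA]
  refine exists_nonneg_combination A id v fun φ hφ => ?_
  obtain ⟨ξ, hξ⟩ := exists_dotProduct_eq φ
  rw [hξ]
  rcases eq_or_ne ξ 0 with rfl | hξ0
  · simp
  set η : Fin n → ℝ := (-‖ξ‖⁻¹) • ξ with hη
  have hnpos : 0 < ‖ξ‖ := norm_pos_iff.2 hξ0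
  have hηK : η ∈ K := by
    refine ⟨?_, ?_⟩
    · simp [hη, norm_smul, hnpos.ne']
    · simp only [Set.mem_iInter]
      intro α hα
      have := hφ α hα
      rw [id, hξ] at this
      simp only [Set.mem_ofPred_eq, hη, dotProduct_smul, smul_eq_mul]
      have : 0 ≤ ‖ξ‖⁻¹ * (α ⬝ᵥ ξ) := by positivity
      linarith
  have h1 : v ⬝ᵥ η ≤ 0 := by
    have e1 : v ⬝ᵥ η = ∑ j, η j + (v - diag n 1) ⬝ᵥ η := by
      rw [sub_dotProduct, diag_dotProduct]; ring
    have e2 : (v - diag n 1) ⬝ᵥ η ≤ ∑ _j : Fin n, c / (n + 1) := by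
      refine Finset.sum_le_sum fun j _ => ?_
      have a1 : |(v - diag n 1) j| ≤ c / (n + 1) :=
        (norm_le_pi_norm (v - diag n 1) j).trans (by
          rw [← dist_eq_norm]; exact (Metric.mem_ball.1 hv).le)
      have a2 : |η j| ≤ 1 := (norm_le_pi_norm η j).trans (hKmem _ hηK).2.2.le
      calc _ ≤ |(v - diag n 1) j * η j| := le_abs_self _
        _ = |(v - diag n 1) j| * |η j| := abs_mul _ _
        _ ≤ c / (n + 1) * 1 := by gcongr
        _ = _ := mul_one _
    have e3 : ∑ _j : Fin n, c / (n + 1) ≤ c := by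
      rw [Finset.sum_const, Finset.card_univ, Fintype.card_fin, nsmul_eq_mul]
      rw [mul_div_assoc', div_le_iff₀ (by positivity)]
      nlinarith
    have := hcK η hηK
    linarith
  rw [hη, dotProduct_smul, smul_eq_mul] at h1
  by_contra hneg
  push Not at hneg
  have : 0 < ‖ξ‖⁻¹ := by positivity
  nlinarith

/-! ### Strict complementarity for the ray through `(1, …, 1)` -/

theorem exists_weights_of_mem_convexHull {A : Finset (Fin n → ℝ)} {x : Fin n → ℝ}
    (hx : x ∈ convexHull ℝ (A : Set (Fin n → ℝ))) :
    ∃ w : (Fin n → ℝ) → ℝ, (∀ α, 0 ≤ w α) ∧ ∑ α ∈ A, w α = 1 ∧ ∑ α ∈ A, w α • α = x := by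
  classical
  obtain ⟨w, hw0, hw1, hwx⟩ := Finset.mem_convexHull'.1 hx
  refine ⟨fun α => if α ∈ A then w α else 0, fun α => ?_, ?_, ?_⟩
  · dsimp only
    split_ifs with h
    · exact hw0 α h
    · exact le_rfl
  · rw [← hw1]
    exact Finset.sum_congr rfl fun α hα => by simp only [if_pos hα]
  · rw [← hwx]
    exact Finset.sum_congr rfl fun α hα => by simp only [if_pos hα]

theorem mem_convexHull_of_weights {A : Finset (Fin n → ℝ)} {w : (Fin n → ℝ) → ℝ}
    (hw : ∀ α, 0 ≤ w α) (hw1 : ∑ α ∈ A, w α = 1) :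
    ∑ α ∈ A, w α • α ∈ convexHull ℝ (A : Set (Fin n → ℝ)) :=
  Finset.mem_convexHull'.2 ⟨w, fun α _ => hw α, hw1, rfl⟩

/-- Farkas' lemma for the homogenized points `(β, 1)`, `β ∈ A`, and `-(p, 1)`: either some linear form
is nonnegative on all of them and positive at `(e, t)`, or `-(e, t)` is in the cone they generate. -/
theorem exists_homogeneous_form_or_combination (A : Finset (Fin n → ℝ)) (p e : Fin n → ℝ) (t : ℝ) :
    (∃ φ : ((Fin n → ℝ) × ℝ) →ₗ[ℝ] ℝ, (∀ β ∈ A, 0 ≤ φ (β, 1)) ∧ φ (p, 1) ≤ 0 ∧ 0 < φ (e, t)) ∨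
    ∃ (c : ℝ) (μ : (Fin n → ℝ) → ℝ), (∀ β, 0 ≤ μ β) ∧
      c • p = e + ∑ β ∈ A, μ β • β ∧ c = t + ∑ β ∈ A, μ β := by
  classical
  by_cases h : ∃ φ : ((Fin n → ℝ) × ℝ) →ₗ[ℝ] ℝ,
    (∀ β ∈ A, 0 ≤ φ (β, 1)) ∧ φ (p, 1) ≤ 0 ∧ 0 < φ (e, t)
  · exact Or.inl h
  right
  push Not at h
  obtain ⟨μ, hμ, hμe⟩ := exists_nonneg_combination (Finset.insertNone A)
    (fun o => o.elim (-(p, (1 : ℝ))) fun β => (β, (1 : ℝ))) (-(e, t)) (by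
      intro φ hφ
      have h1 : ∀ β ∈ A, 0 ≤ φ (β, 1) := fun β hβ => hφ (some β) (by simpa using hβ)
      have h2 : φ (p, 1) ≤ 0 := by
        have := hφ none (by simp)
        simp only [Option.elim, map_neg] at this
        linarith
      rw [map_neg]
      linarith [h φ h1 h2])
  refine ⟨μ none, fun β => μ (some β), fun β => hμ _, ?_, ?_⟩
  · have := congrArg Prod.fst hμe
    simp only [Finset.sum_insertNone, Option.elim, Prod.fst_neg, Prod.fst_add, Prod.smul_fst,
      Prod.fst_sum, smul_neg] at this
    rw [neg_eq_iff_eq_neg] at this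
    rw [this]
    abel
  · have := congrArg Prod.snd hμe
    simp only [Finset.sum_insertNone, Option.elim, Prod.snd_neg, Prod.snd_add, Prod.smul_snd,
      Prod.snd_sum, smul_neg, smul_eq_mul, mul_one] at this
    linarith

/-- A strictly complementary pair of optimal solutions of the linear program that maximizes `t` subject
to `(t, …, t) ∈ conv A`, with value `d`. The form `ξ₀` is at most `1` on `A`, and the weights `w`
represent `(d, …, d)` as a convex combination of `A` and are positive exactly at the *active* points,
those where `ξ₀` equals `1`. -/
structure IsComplementaryPair (A : Finset (Fin n → ℝ)) (d : ℝ) (ξ₀ : Fin n → ℝ)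
    (w : (Fin n → ℝ) → ℝ) : Prop where
  le_one : ∀ α ∈ A, α ⬝ᵥ ξ₀ ≤ 1
  nonneg : ∀ α, 0 ≤ w α
  pos : ∀ α ∈ A, α ⬝ᵥ ξ₀ = 1 → 0 < w α
  eq_zero : ∀ α ∈ A, α ⬝ᵥ ξ₀ ≠ 1 → w α = 0
  sum_eq_one : ∑ α ∈ A, w α = 1
  sum_smul : ∑ α ∈ A, w α • α = diag n d

/-- Strict complementarity. For each `α ∈ A`, either some convex representation of `p = (d, …, d)` gives
`α` positive weight, or some homogenized form, nonnegative on `A` and nonpositive at `p`, is positive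
at `α`. Averaging the representations and adding up the forms settles all `α` at once. -/
theorem exists_strictly_complementary (hn : 0 < n) {A : Finset (Fin n → ℝ)} {d : ℝ}
    (hd : IsFarthestDiag (convexHull ℝ (A : Set (Fin n → ℝ))) d) :
    ∃ ξ₀ w, IsComplementaryPair A d ξ₀ w := by
  classical
  obtain ⟨⟨hd0, hdmem⟩, hdmax⟩ := hd
  set p := diag n d with hp
  let IsRep : ((Fin n → ℝ) → ℝ) → Prop := fun w =>
    (∀ α, 0 ≤ w α) ∧ ∑ α ∈ A, w α = 1 ∧ ∑ α ∈ A, w α • α = p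
  -- By maximality of `d` some form with positive constant term vanishes at `p`.
  obtain ⟨φ₁, h₁A, h₁p, h₁⟩ : ∃ φ : ((Fin n → ℝ) × ℝ) →ₗ[ℝ] ℝ,
      (∀ β ∈ A, 0 ≤ φ (β, 1)) ∧ φ (p, 1) ≤ 0 ∧ 0 < φ (0, 1) := by
    refine (exists_homogeneous_form_or_combination A p 0 1).resolve_right ?_
    rintro ⟨c, μ, hμ, hcp, hc⟩
    rw [zero_add] at hcp
    rcases (Finset.sum_nonneg fun α (_ : α ∈ A) => hμ α).eq_or_lt with h0 | hpos
    · have hz : c • p = 0 := by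
        rw [hcp]
        refine Finset.sum_eq_zero fun β hβ => ?_
        rw [(Finset.sum_eq_zero_iff_of_nonneg fun α _ => hμ α).1 h0.symm β hβ, zero_smul]
      have := congrFun hz ⟨0, hn⟩
      rw [← h0] at hc
      simp only [hp, diag, Pi.smul_apply, smul_eq_mul, Pi.zero_apply, hc] at this
      linarith
    · set S := ∑ α ∈ A, μ α with hS
      have hmem : diag n (S⁻¹ * c * d) ∈ convexHull ℝ (A : Set (Fin n → ℝ)) := by
        have := mem_convexHull_of_weights (A := A) (w := fun α => S⁻¹ * μ α)
          (fun α => mul_nonneg (inv_nonneg.2 hpos.le) (hμ α))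
          (by rw [← Finset.mul_sum, inv_mul_cancel₀ hpos.ne'])
        simp only [← smul_smul, ← Finset.smul_sum, ← hcp] at this
        convert this using 1
        ext j
        simp [hp, diag, mul_assoc]
      have hgt : 1 < S⁻¹ * c := by
        rw [hc, mul_add, inv_mul_cancel₀ hpos.ne']
        have : 0 < S⁻¹ := inv_pos.2 hpos
        linarith
      have := hdmax ⟨by positivity, hmem⟩
      nlinarith
  have key : ∀ α, ∃ φ : ((Fin n → ℝ) × ℝ) →ₗ[ℝ] ℝ, (∀ β ∈ A, 0 ≤ φ (β, 1)) ∧ φ (p, 1) ≤ 0 ∧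
      (α ∈ A → (∃ w, IsRep w ∧ 0 < w α) ∨ 0 < φ (α, 1)) := by
    intro α
    rcases exists_homogeneous_form_or_combination A p α 1 with ⟨φ, h1, h2, h3⟩ | ⟨c, μ, hμ, hcp, hc⟩
    · exact ⟨φ, h1, h2, fun _ => Or.inr h3⟩
    · refine ⟨0, by simp, by simp, fun hα => Or.inl ?_⟩
      have hcpos : 0 < c := by
        rw [hc]; linarith [Finset.sum_nonneg fun α (_ : α ∈ A) => hμ α]
      refine ⟨fun β => c⁻¹ * (μ β + if β = α then 1 else 0), ⟨fun β => ?_, ?_, ?_⟩, ?_⟩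
      · refine mul_nonneg (inv_nonneg.2 hcpos.le) (add_nonneg (hμ β) ?_)
        split_ifs <;> norm_num
      · rw [← Finset.mul_sum, Finset.sum_add_distrib, Finset.sum_ite_eq' A α, if_pos hα, add_comm,
          ← hc, inv_mul_cancel₀ hcpos.ne']
      · simp only [← smul_smul, ← Finset.smul_sum, add_smul, Finset.sum_add_distrib, ite_smul,
          one_smul, zero_smul]
        rw [Finset.sum_ite_eq' A α, if_pos hα, add_comm, ← hcp, smul_smul,
          inv_mul_cancel₀ hcpos.ne', one_smul]
      · have := hμ α
        simp only [if_true]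
        positivity
  choose φ hφA hφp hφ using key
  obtain ⟨w₀, hw₀⟩ : ∃ w, IsRep w := exists_weights_of_mem_convexHull hdmem
  have hrep : ∀ α, ∃ w, IsRep w ∧ ((∃ w, IsRep w ∧ 0 < w α) → 0 < w α) := by
    intro α
    by_cases h : ∃ w, IsRep w ∧ 0 < w α
    · obtain ⟨w, h1, h2⟩ := h
      exact ⟨w, h1, fun _ => h2⟩
    · exact ⟨w₀, hw₀, fun h' => absurd h' h⟩
  choose W hW hWpos using hrep
  have hAne : A.Nonempty := by
    rw [Finset.nonempty_iff_ne_empty]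
    rintro rfl
    simpa using hw₀.2.1
  have hcard : (0 : ℝ) < (A.card : ℝ) := by exact_mod_cast hAne.card_pos
  set Φ := φ₁ + ∑ α ∈ A, φ α with hΦ
  have hΦv : ∀ v, Φ v = φ₁ v + ∑ α ∈ A, φ α v := fun v => by
    rw [hΦ, LinearMap.add_apply, LinearMap.sum_apply]
  have hΦp : Φ (p, 1) ≤ 0 := by
    rw [hΦv]; exact add_nonpos h₁p (Finset.sum_nonpos fun α _ => hφp α)
  have hΦA : ∀ β ∈ A, 0 ≤ Φ (β, 1) := fun β hβ => by
    rw [hΦv]; exact add_nonneg (h₁A β hβ) (Finset.sum_nonneg fun α _ => hφA α β hβ)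
  have hle : ∀ α ∈ A, ∀ β ∈ A, φ α (β, 1) ≤ Φ (β, 1) := fun α hα β hβ => by
    rw [hΦv]
    have := Finset.single_le_sum (fun γ _ => hφA γ β hβ) hα (f := fun γ => φ γ (β, 1))
    linarith [h₁A β hβ]
  -- `Φ` may have a negative constant term, which a multiple of `φ₁` outweighs.
  obtain ⟨N, hN, hNpos⟩ : ∃ N : ℝ, 0 ≤ N ∧ 0 < Φ (0, 1) + N * φ₁ (0, 1) := by
    refine ⟨(|Φ (0, 1)| + 1) / φ₁ (0, 1), by positivity, ?_⟩
    rw [div_mul_cancel₀ _ h₁.ne']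
    linarith [neg_abs_le (Φ (0, 1))]
  set s := Φ (0, 1) + N * φ₁ (0, 1) with hs
  set Ψ := Φ + N • φ₁ with hΨ
  have hΨv : ∀ v, Ψ v = Φ v + N * φ₁ v := fun v => by simp [hΨ]
  obtain ⟨ξ, hξ⟩ := exists_dotProduct_eq (Ψ ∘ₗ LinearMap.inl ℝ (Fin n → ℝ) ℝ)
  have hform : ∀ x, Ψ (x, 1) = s * (1 - x ⬝ᵥ (-s⁻¹ • ξ)) := by
    intro x
    have e1 : Ψ (x, 1) = Ψ (x, 0) + Ψ (0, 1) := by rw [← map_add]; simp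
    have e2 : Ψ (x, 0) = x ⬝ᵥ ξ := hξ x
    rw [e1, e2, hΨv (0, 1), ← hs, dotProduct_smul, smul_eq_mul]
    field_simp
    ring
  have hΨA : ∀ β ∈ A, Φ (β, 1) ≤ Ψ (β, 1) := fun β hβ => by
    rw [hΨv]; have := mul_nonneg hN (h₁A β hβ); linarith
  have hΨp : Ψ (p, 1) ≤ 0 := by
    rw [hΨv]; have := mul_nonpos_of_nonneg_of_nonpos hN h₁p; linarith
  set w : (Fin n → ℝ) → ℝ := fun β => (A.card : ℝ)⁻¹ * ∑ α ∈ A, W α β with hw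
  have hw1 : ∑ β ∈ A, w β = 1 := by
    simp only [hw]
    rw [← Finset.mul_sum, Finset.sum_comm, Finset.sum_congr rfl fun α _ => (hW α).2.1]
    simp [hcard.ne']
  have hwp : ∑ β ∈ A, w β • β = p := by
    simp only [hw, ← smul_smul, ← Finset.smul_sum, Finset.sum_smul]
    rw [Finset.sum_comm, Finset.sum_congr rfl fun α _ => (hW α).2.2, Finset.sum_const,
      ← Nat.cast_smul_eq_nsmul ℝ, smul_smul, inv_mul_cancel₀ hcard.ne', one_smul]
  have hw0 : ∀ β, 0 ≤ w β := fun β =>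
    mul_nonneg (inv_nonneg.2 hcard.le) (Finset.sum_nonneg fun α _ => (hW α).1 β)
  have hsum : ∑ β ∈ A, w β * Ψ (β, 1) = Ψ (p, 1) := by
    have : ((p, 1) : (Fin n → ℝ) × ℝ) = ∑ β ∈ A, w β • (β, (1 : ℝ)) := by
      ext1
      · simp [Prod.fst_sum, hwp]
      · simp [Prod.snd_sum, hw1]
    rw [this, map_sum]
    exact Finset.sum_congr rfl fun β _ => by rw [map_smul, smul_eq_mul]
  refine ⟨-s⁻¹ • ξ, w, fun α hα => ?_, hw0, fun α hα h1 => ?_, fun α hα h1 => ?_, hw1, hwp⟩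
  · have := (hΦA α hα).trans (hΨA α hα)
    rw [hform] at this
    have := nonneg_of_mul_nonneg_right this hNpos
    linarith
  · have h0 : Ψ (α, 1) = 0 := by rw [hform, h1, sub_self, mul_zero]
    have hact : ∃ w, IsRep w ∧ 0 < w α := by
      refine (hφ α hα).resolve_right fun h => ?_
      linarith [hle α hα α hα, hΨA α hα]
    refine mul_pos (inv_pos.2 hcard) ?_
    exact Finset.sum_pos' (fun γ _ => (hW γ).1 α) ⟨α, hα, hWpos α hact⟩
  · have hnn : ∀ β ∈ A, 0 ≤ w β * Ψ (β, 1) := fun β hβ =>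
      mul_nonneg (hw0 β) ((hΦA β hβ).trans (hΨA β hβ))
    have hz := (Finset.sum_eq_zero_iff_of_nonneg hnn).1
      (le_antisymm (hsum.le.trans hΨp) (Finset.sum_nonneg hnn)) α hα
    refine (mul_eq_zero.1 hz).resolve_right fun h => h1 ?_
    rw [hform] at h
    have := (mul_eq_zero.1 h).resolve_left hNpos.ne'
    linarith

/-! ### The smallest face at the farthest diagonal point -/

/-- The homothety with centre `y` and ratio `t` maps `C` into `C` and is a homeomorphism of the affine
span, so it maps relative interior points to relative interior points. -/
theorem combo_mem_intrinsicInterior {C : Set (Fin n → ℝ)} (hC : Convex ℝ C) {q y : Fin n → ℝ}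
    (hq : q ∈ intrinsicInterior ℝ C) (hy : y ∈ C) {t : ℝ} (ht : 0 < t) (ht1 : t ≤ 1) :
    y + t • (q - y) ∈ intrinsicInterior ℝ C := by
  have hyS : y ∈ affineSpan ℝ C := subset_affineSpan ℝ C hy
  have hmem : ∀ (c : ℝ) (x : Fin n → ℝ), x ∈ affineSpan ℝ C → y + c • (x - y) ∈ affineSpan ℝ C := by
    intro c x hx
    have := AffineMap.lineMap_mem c hyS hx
    rwa [AffineMap.lineMap_apply, vsub_eq_sub, vadd_eq_add, add_comm] at this
  obtain ⟨q', hq', rfl⟩ := hq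
  let g : affineSpan ℝ C → affineSpan ℝ C := fun x => ⟨y + t⁻¹ • ((x : Fin n → ℝ) - y), hmem _ _ x.2⟩
  have hg : Continuous g := by
    apply Continuous.subtype_mk
    fun_prop
  refine ⟨⟨y + t • ((q' : Fin n → ℝ) - y), hmem _ _ q'.2⟩, ?_, rfl⟩
  rw [mem_interior]
  refine ⟨g ⁻¹' interior ((↑) ⁻¹' C), fun x hx => ?_, isOpen_interior.preimage hg, ?_⟩
  · have h1 : y + t⁻¹ • ((x : Fin n → ℝ) - y) ∈ C :=
      interior_subset (s := ((↑) ⁻¹' C : Set (affineSpan ℝ C))) hx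
    have h2 := hC.add_smul_sub_mem hy h1 ⟨ht.le, ht1⟩
    rw [add_sub_cancel_left, smul_smul, mul_inv_cancel₀ ht.ne', one_smul] at h2
    simpa using h2
  · have : g ⟨y + t • ((q' : Fin n → ℝ) - y), hmem _ _ q'.2⟩ = q' := by
      apply Subtype.ext
      simp only [g, add_sub_cancel_left, smul_smul, inv_mul_cancel₀ ht.ne', one_smul]
      abel
    rw [Set.mem_preimage, this]
    exact hq'

/-- A convex combination with positive weights lies in the relative interior: it is a point of the
segment from some relative interior point `q` to a point of the hull, other than the latter. -/
theorem sum_smul_mem_intrinsicInterior {B : Finset (Fin n → ℝ)} {w : (Fin n → ℝ) → ℝ}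
    (hB : B.Nonempty) (hw : ∀ α ∈ B, 0 < w α) (hw1 : ∑ α ∈ B, w α = 1) :
    ∑ α ∈ B, w α • α ∈ intrinsicInterior ℝ (convexHull ℝ (B : Set (Fin n → ℝ))) := by
  have hconv : Convex ℝ (convexHull ℝ (B : Set (Fin n → ℝ))) := convex_convexHull ℝ _
  obtain ⟨q, hq⟩ := Set.Nonempty.intrinsicInterior hconv
    ((convexHull_nonempty_iff (𝕜 := ℝ)).2 (Finset.coe_nonempty.2 hB))
  obtain ⟨μ, hμ, hμ1, hμq⟩ := exists_weights_of_mem_convexHull (intrinsicInterior_subset hq)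
  obtain ⟨α₀, hα₀, hmin⟩ := B.exists_min_image w hB
  set t : ℝ := min (w α₀) (1 / 2) with ht
  have ht0 : 0 < t := lt_min (hw _ hα₀) (by norm_num)
  have ht1 : t ≤ 1 / 2 := min_le_right _ _
  have h1t : 0 < 1 - t := by linarith
  have hμle : ∀ α ∈ B, μ α ≤ 1 := fun α hα => by
    rw [← hμ1]; exact Finset.single_le_sum (fun β _ => hμ β) hα
  set z := ∑ α ∈ B, w α • α with hz
  have hy : (1 - t)⁻¹ • (z - t • q) ∈ convexHull ℝ (B : Set (Fin n → ℝ)) := by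
    refine Finset.mem_convexHull'.2 ⟨fun α => (1 - t)⁻¹ * (w α - t * μ α), fun α hα => ?_, ?_, ?_⟩
    · refine mul_nonneg (inv_nonneg.2 h1t.le) ?_
      have h1 : t ≤ w α := (min_le_left _ _).trans (hmin α hα)
      nlinarith [hμ α, hμle α hα]
    · rw [← Finset.mul_sum, Finset.sum_sub_distrib, ← Finset.mul_sum, hw1, hμ1, mul_one,
        inv_mul_cancel₀ h1t.ne']
    · simp only [← smul_smul, ← Finset.smul_sum, sub_smul, Finset.sum_sub_distrib, ← hz, hμq]
  have := combo_mem_intrinsicInterior hconv hq hy ht0 (by linarith)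
  convert this using 1
  have : z = (1 - t) • ((1 - t)⁻¹ • (z - t • q)) + t • q := by
    rw [smul_smul, mul_inv_cancel₀ h1t.ne', one_smul]; abel
  conv_lhs => rw [this]
  module

namespace IsComplementaryPair

variable {A : Finset (Fin n → ℝ)} {d : ℝ} {ξ₀ : Fin n → ℝ} {w : (Fin n → ℝ) → ℝ}

theorem sum_filter_eq_one (h : IsComplementaryPair A d ξ₀ w) :
    ∑ α ∈ A with α ⬝ᵥ ξ₀ = 1, w α = 1 := by
  refine Eq.trans ?_ h.sum_eq_one
  rw [Finset.sum_filter]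
  refine Finset.sum_congr rfl fun α hα => ?_
  split_ifs with h1
  · rfl
  · exact (h.eq_zero α hα h1).symm

theorem sum_filter_smul (h : IsComplementaryPair A d ξ₀ w) :
    ∑ α ∈ A with α ⬝ᵥ ξ₀ = 1, w α • α = diag n d := by
  rw [← h.sum_smul, Finset.sum_filter]
  refine Finset.sum_congr rfl fun α hα => ?_
  split_ifs with h1
  · rfl
  · rw [h.eq_zero α hα h1, zero_smul]

theorem filter_nonempty (h : IsComplementaryPair A d ξ₀ w) :
    (A.filter fun α => α ⬝ᵥ ξ₀ = 1).Nonempty := by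
  rw [Finset.nonempty_iff_ne_empty]
  intro h0
  simpa [h0] using h.sum_filter_eq_one

theorem mul_sum_eq_one (h : IsComplementaryPair A d ξ₀ w) : d * ∑ j, ξ₀ j = 1 := by
  rw [← diag_dotProduct, ← h.sum_filter_smul, sum_smul_dotProduct]
  refine Eq.trans ?_ h.sum_filter_eq_one
  refine Finset.sum_congr rfl fun α hα => ?_
  rw [(Finset.mem_filter.1 hα).2, mul_one]

theorem dotProduct_le_one (h : IsComplementaryPair A d ξ₀ w) {x : Fin n → ℝ}
    (hx : x ∈ convexHull ℝ (A : Set (Fin n → ℝ))) : x ⬝ᵥ ξ₀ ≤ 1 := by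
  obtain ⟨μ, hμ, hμ1, rfl⟩ := exists_weights_of_mem_convexHull hx
  rw [sum_smul_dotProduct, ← hμ1]
  exact Finset.sum_le_sum fun α hα => mul_le_of_le_one_right (hμ α) (h.le_one α hα)

theorem face_eq_convexHull (h : IsComplementaryPair A d ξ₀ w) :
    {x ∈ convexHull ℝ (A : Set (Fin n → ℝ)) | x ⬝ᵥ ξ₀ = 1} =
      convexHull ℝ ((A.filter fun α => α ⬝ᵥ ξ₀ = 1 : Finset (Fin n → ℝ)) : Set (Fin n → ℝ)) := by
  apply Set.Subset.antisymm
  · rintro x ⟨hx, hx1⟩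
    obtain ⟨μ, hμ, hμ1, rfl⟩ := exists_weights_of_mem_convexHull hx
    have hnn : ∀ α ∈ A, 0 ≤ μ α * (1 - α ⬝ᵥ ξ₀) := fun α hα =>
      mul_nonneg (hμ α) (sub_nonneg.2 (h.le_one α hα))
    have hsum : ∑ α ∈ A, μ α * (1 - α ⬝ᵥ ξ₀) = 0 := by
      rw [sum_smul_dotProduct] at hx1
      simp only [mul_sub, mul_one, Finset.sum_sub_distrib]
      rw [hμ1, hx1, sub_self]
    have hz : ∀ α ∈ A, ¬ α ⬝ᵥ ξ₀ = 1 → μ α = 0 := fun α hα h1 =>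
      (mul_eq_zero.1 ((Finset.sum_eq_zero_iff_of_nonneg hnn).1 hsum α hα)).resolve_right
        fun h2 => h1 (by linarith)
    have e1 : ∑ α ∈ A, μ α • α = ∑ α ∈ A with α ⬝ᵥ ξ₀ = 1, μ α • α := by
      rw [Finset.sum_filter]
      refine Finset.sum_congr rfl fun α hα => ?_
      split_ifs with h1
      · rfl
      · rw [hz α hα h1, zero_smul]
    have e2 : ∑ α ∈ A with α ⬝ᵥ ξ₀ = 1, μ α = 1 := by
      refine Eq.trans ?_ hμ1
      rw [Finset.sum_filter]
      refine Finset.sum_congr rfl fun α hα => ?_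
      split_ifs with h1
      · rfl
      · exact (hz α hα h1).symm
    rw [e1]
    exact mem_convexHull_of_weights hμ e2
  · intro x hx
    refine ⟨convexHull_mono (Finset.coe_subset.2 (Finset.filter_subset _ _)) hx, ?_⟩
    obtain ⟨μ, hμ, hμ1, rfl⟩ := exists_weights_of_mem_convexHull hx
    rw [sum_smul_dotProduct]
    refine Eq.trans ?_ hμ1
    refine Finset.sum_congr rfl fun α hα => ?_
    rw [(Finset.mem_filter.1 hα).2, mul_one]

/-- Every face through `(d, …, d)` contains the active points, as these have positive weight in a convex
representation of `(d, …, d)`. -/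
theorem isSmallestFaceAt (h : IsComplementaryPair A d ξ₀ w) :
    IsSmallestFaceAt (convexHull ℝ (A : Set (Fin n → ℝ))) (diag n d)
      {x ∈ convexHull ℝ (A : Set (Fin n → ℝ)) | x ⬝ᵥ ξ₀ = 1} := by
  have hint : diag n d ∈ intrinsicInterior ℝ
      {x ∈ convexHull ℝ (A : Set (Fin n → ℝ)) | x ⬝ᵥ ξ₀ = 1} := by
    rw [h.face_eq_convexHull, ← h.sum_filter_smul]
    refine sum_smul_mem_intrinsicInterior h.filter_nonempty (fun α hα => ?_) h.sum_filter_eq_one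
    exact h.pos α (Finset.mem_filter.1 hα).1 (Finset.mem_filter.1 hα).2
  have hmem := intrinsicInterior_subset hint
  refine ⟨⟨⟨⟨_, hmem⟩, ?_⟩, hint⟩, ?_⟩
  · convert isExposed_setOf_dotProduct_le (convexHull ℝ (A : Set (Fin n → ℝ))) ξ₀ using 1
    ext x
    constructor
    · rintro ⟨hx, hx1⟩
      refine ⟨hx, fun y hy => ?_⟩
      rw [hx1]
      exact h.dotProduct_le_one hy
    · rintro ⟨hx, hx1⟩
      refine ⟨hx, le_antisymm (h.dotProduct_le_one hx) ?_⟩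
      have : diag n d ⬝ᵥ ξ₀ ≤ x ⬝ᵥ ξ₀ := hx1 _ hmem.1
      rwa [hmem.2] at this
  · intro F' hF' hdF'
    have hsub : {x ∈ convexHull ℝ (A : Set (Fin n → ℝ)) | x ⬝ᵥ ξ₀ = 1} ⊆ F' := by
      have hconv : Convex ℝ F' := hF'.2.convex (convex_convexHull ℝ _)
      obtain ⟨l, hl⟩ := hF'.2 hF'.1
      have hp : diag n d ∈ F' := intrinsicInterior_subset hdF'
      rw [h.face_eq_convexHull]
      refine convexHull_min (fun α hα => ?_) hconv
      obtain ⟨hαA, hα1⟩ := Finset.mem_filter.1 (Finset.mem_coe.1 hα)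
      rw [hl] at hp ⊢
      have hle : ∀ β ∈ A, l β ≤ l (diag n d) := fun β hβ => hp.2 β (subset_convexHull ℝ _ hβ)
      have hsum : ∑ β ∈ A, w β * (l (diag n d) - l β) = 0 := by
        simp only [mul_sub, Finset.sum_sub_distrib]
        rw [← Finset.sum_mul, h.sum_eq_one, one_mul, sub_eq_zero]
        conv_lhs => rw [← h.sum_smul, map_sum]
        simp
      have hz := (Finset.sum_eq_zero_iff_of_nonneg fun β hβ =>
        mul_nonneg (h.nonneg β) (sub_nonneg.2 (hle β hβ))).1 hsum α hαA
      have := (mul_eq_zero.1 hz).resolve_left (h.pos α hαA hα1).ne'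
      refine ⟨subset_convexHull ℝ _ hαA, fun y hy => ?_⟩
      have := hp.2 y hy
      linarith
    exact Submodule.finrank_mono (vectorSpan_mono ℝ hsub)

/-- The face lies in the hyperplane `⟨·, ξ₀⟩ = 1`, which misses the origin, so passing from its direction
to the linear span of the active points raises the dimension by one. -/
theorem finrank_span_eq (h : IsComplementaryPair A d ξ₀ w) :
    Module.finrank ℝ (Submodule.span ℝ
      ((A.filter fun α => α ⬝ᵥ ξ₀ = 1 : Finset (Fin n → ℝ)) : Set (Fin n → ℝ))) =
      affDim {x ∈ convexHull ℝ (A : Set (Fin n → ℝ)) | x ⬝ᵥ ξ₀ = 1} + 1 := by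
  rw [h.face_eq_convexHull, affDim, ← direction_affineSpan, affineSpan_convexHull,
    direction_affineSpan]
  set B := A.filter fun α => α ⬝ᵥ ξ₀ = 1 with hB
  obtain ⟨α₀, hα₀⟩ := h.filter_nonempty
  have h0 : α₀ ⬝ᵥ ξ₀ = 1 := (Finset.mem_filter.1 hα₀).2
  have hker : ∀ x ∈ vectorSpan ℝ (B : Set (Fin n → ℝ)), x ⬝ᵥ ξ₀ = 0 := by
    intro x hx
    rw [vectorSpan_eq_span_vsub_set_right ℝ (Finset.mem_coe.2 hα₀)] at hx
    induction hx using Submodule.span_induction with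
    | mem x hx =>
      obtain ⟨α, hα, rfl⟩ := hx
      have := (Finset.mem_filter.1 (Finset.mem_coe.1 hα)).2
      simp [sub_dotProduct, this, h0]
    | zero => simp
    | add x y _ _ hx hy => rw [add_dotProduct, hx, hy, add_zero]
    | smul c x _ hx => rw [smul_dotProduct, hx, smul_zero]
  have hne : α₀ ≠ 0 := by rintro rfl; simp at h0
  have hsup : Submodule.span ℝ (B : Set (Fin n → ℝ)) =
      vectorSpan ℝ (B : Set (Fin n → ℝ)) ⊔ Submodule.span ℝ {α₀} := by
    apply le_antisymm
    · rw [Submodule.span_le]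
      intro α hα
      have : α = (α -ᵥ α₀) + α₀ := by simp
      rw [this]
      exact Submodule.add_mem_sup (vsub_mem_vectorSpan ℝ hα (Finset.mem_coe.2 hα₀))
        (Submodule.mem_span_singleton_self _)
    · refine sup_le ?_ (Submodule.span_mono (Set.singleton_subset_iff.2 hα₀))
      rw [vectorSpan_eq_span_vsub_set_right ℝ (Finset.mem_coe.2 hα₀), Submodule.span_le]
      rintro _ ⟨α, hα, rfl⟩
      exact Submodule.sub_mem _ (Submodule.subset_span hα) (Submodule.subset_span hα₀)
  have hinf : vectorSpan ℝ (B : Set (Fin n → ℝ)) ⊓ Submodule.span ℝ {α₀} = ⊥ := by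
    rw [eq_bot_iff]
    rintro x ⟨hx1, hx2⟩
    obtain ⟨c, rfl⟩ := Submodule.mem_span_singleton.1 hx2
    have := hker _ hx1
    rw [smul_dotProduct, h0, smul_eq_mul, mul_one] at this
    simp [this]
  have := Submodule.finrank_sup_add_finrank_inf_eq (vectorSpan ℝ (B : Set (Fin n → ℝ)))
    (Submodule.span ℝ {α₀})
  rw [hinf, finrank_bot, add_zero, finrank_span_singleton hne, ← hsup] at this
  exact this

end IsComplementaryPair

/-- A basis of `ℝⁿ` whose members indexed by `I` belong to `B` and span the same subspace as `B`. -/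
theorem exists_basis_adapted (B : Set (Fin n → ℝ)) :
    ∃ (b : Module.Basis (Fin n) ℝ (Fin n → ℝ)) (I : Finset (Fin n)),
      I.card = Module.finrank ℝ (Submodule.span ℝ B) ∧ (∀ i ∈ I, b i ∈ B) ∧
      ∀ x ∈ Submodule.span ℝ B, ∀ j ∉ I, b.repr x j = 0 := by
  classical
  obtain ⟨B₀, hsub, hspan, hli⟩ := exists_linearIndependent ℝ B
  have hli' : LinearIndepOn ℝ id B₀ := hli
  let b₀ := Module.Basis.extend hli'
  have : Fintype (hli'.extend (Set.subset_univ B₀)) := FiniteDimensional.fintypeBasisIndex b₀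
  have hcard : Fintype.card (hli'.extend (Set.subset_univ B₀)) = Fintype.card (Fin n) := by
    rw [← Module.finrank_eq_card_basis b₀, Module.finrank_fin_fun, Fintype.card_fin]
  let e := Fintype.equivOfCardEq hcard
  let b := b₀.reindex e
  have hb : ∀ i, b i = (e.symm i : Fin n → ℝ) := fun i => by simp [b, b₀]
  have hBb : b '' {i | b i ∈ B₀} = B₀ := by
    ext x
    constructor
    · rintro ⟨i, hi, rfl⟩; exact hi
    · intro hx
      refine ⟨e ⟨x, hli'.subset_extend _ hx⟩, ?_, ?_⟩ <;> simp [hb, hx]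
  refine ⟨b, Finset.univ.filter fun i => b i ∈ B₀, ?_, fun i hi => hsub (by simpa using hi), ?_⟩
  · have : LinearIndependent ℝ fun i : (Finset.univ.filter fun i => b i ∈ B₀) => b i :=
      b.linearIndependent.comp _ Subtype.val_injective
    have h2 := finrank_span_eq_card this
    rw [Fintype.card_coe] at h2
    have h3 : (Set.range fun i : (Finset.univ.filter fun i => b i ∈ B₀) => b i) = B₀ := by
      refine Eq.trans ?_ hBb
      ext x
      simp
    rw [← h2, h3, hspan]
  · intro x hx j hj
    rw [← hspan, ← hBb] at hx
    have := b.mem_span_image.1 hx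
    by_contra hne
    exact hj (by simpa using this (Finsupp.mem_support_iff.2 hne))

/-! ### Two-sided bounds for the volume in logarithmic coordinates -/

theorem integral_exp_neg_mul_abs {κ : ℝ} (hκ : 0 < κ) : ∫ x : ℝ, Real.exp (-(κ * |x|)) = 2 / κ := by
  rw [integral_comp_abs (f := fun x => Real.exp (-(κ * x)))]
  have := integral_exp_mul_Ioi (neg_lt_zero.2 hκ) 0
  simp only [neg_mul, mul_zero, Real.exp_zero] at this
  rw [this]
  field_simp

theorem lintegral_exp_neg_sum_mul_abs {κ : Fin n → ℝ} (hκ : ∀ i, 0 < κ i) :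
    ∫⁻ y : Fin n → ℝ, ENNReal.ofReal (Real.exp (-∑ i, κ i * |y i|)) =
      ENNReal.ofReal (∏ i, 2 / κ i) := by
  have hint : ∀ i, Integrable (fun x : ℝ => Real.exp (-(κ i * |x|))) := fun i => by
    by_contra h
    have h1 := integral_exp_neg_mul_abs (hκ i)
    rw [integral_undef h] at h1
    exact (div_pos two_pos (hκ i)).ne h1
  have hexp : ∀ y : Fin n → ℝ,
      Real.exp (-∑ i, κ i * |y i|) = ∏ i, Real.exp (-(κ i * |y i|)) := fun y => by
    rw [← Finset.sum_neg_distrib, Real.exp_sum]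
  simp only [hexp]
  rw [← ofReal_integral_eq_lintegral_ofReal (by rw [volume_pi]; exact Integrable.fintype_prod hint)
    (ae_of_all _ fun y => Finset.prod_nonneg fun i _ => (Real.exp_pos _).le)]
  rw [integral_fintype_prod_volume_eq_prod (𝕜 := ℝ) (fun i (x : ℝ) => Real.exp (-(κ i * |x|)))]
  simp only [integral_exp_neg_mul_abs (hκ _)]

/-- The affine change of variables `y_i = ⟨b_i, ξ - ξ₀⟩`; its Jacobian constant does not depend on
`ξ₀`. -/
theorem exists_lintegral_basis_coord (b : Module.Basis (Fin n) ℝ (Fin n → ℝ)) :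
    ∃ J : ℝ, 0 < J ∧ ∀ (ξ₀ : Fin n → ℝ) (g : (Fin n → ℝ) → ENNReal), Measurable g →
      ∫⁻ ξ, g (fun i => b i ⬝ᵥ (ξ - ξ₀)) = ENNReal.ofReal J * ∫⁻ y, g y := by
  let T : (Fin n → ℝ) →ₗ[ℝ] (Fin n → ℝ) := Matrix.mulVecLin (Matrix.of fun i => b i)
  have hT : ∀ ζ, T ζ = fun i => b i ⬝ᵥ ζ := fun ζ => rfl
  have hinj : Function.Injective T := by
    rw [injective_iff_map_eq_zero]
    intro ζ hζ
    have h1 : ∀ i, b i ⬝ᵥ ζ = 0 := fun i => congrFun hζ i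
    have h2 : ∀ x : Fin n → ℝ, x ⬝ᵥ ζ = 0 := fun x => by
      rw [← b.sum_repr x, sum_dotProduct]
      simp [smul_dotProduct, h1]
    exact dotProduct_self_eq_zero.1 (h2 ζ)
  have hdet : LinearMap.det T ≠ 0 :=
    (LinearEquiv.ofInjectiveEndo T hinj).isUnit_det'.ne_zero
  refine ⟨|(LinearMap.det T)⁻¹|, abs_pos.2 (inv_ne_zero hdet), fun ξ₀ g hg => ?_⟩
  have hTm : Measurable T := (LinearMap.continuous_of_finiteDimensional T).measurable
  calc ∫⁻ ξ, g (fun i => b i ⬝ᵥ (ξ - ξ₀)) = ∫⁻ ξ, g (T (ξ - ξ₀)) := rfl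
    _ = ∫⁻ ξ, g (T ξ) := lintegral_sub_right_eq_self (fun ξ => g (T ξ)) ξ₀
    _ = ∫⁻ y, g y ∂(Measure.map T volume) := (lintegral_map hg hTm).symm
    _ = _ := by rw [Measure.map_linearMap_addHaar_eq_smul_addHaar volume hdet,
      lintegral_smul_measure, smul_eq_mul]

/-- The region `|x^α| ≤ exp R`, `α ∈ A`, of an open orthant in the coordinates `ξ_j = ln |x_j|`. -/
def logRegion (A : Finset (Fin n → ℝ)) (R : ℝ) : Set (Fin n → ℝ) := {ξ | ∀ α ∈ A, α ⬝ᵥ ξ ≤ R}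

/-- The Lebesgue measure of the region `|x^α| ≤ exp R`, `α ∈ A`, of one open orthant, written in the
coordinates `ξ_j = ln |x_j|`. -/
noncomputable def logVolume (A : Finset (Fin n → ℝ)) (R : ℝ) : ENNReal :=
  ∫⁻ ξ in logRegion A R, ENNReal.ofReal (Real.exp (∑ j, ξ j))

theorem isClosed_logRegion (A : Finset (Fin n → ℝ)) (R : ℝ) : IsClosed (logRegion A R) := by
  have : logRegion A R = ⋂ α ∈ A, {ξ | α ⬝ᵥ ξ ≤ R} := by ext; simp [logRegion]
  rw [this]
  refine isClosed_biInter fun α _ => isClosed_le ?_ continuous_const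
  unfold dotProduct; fun_prop

theorem measurableSet_logRegion (A : Finset (Fin n → ℝ)) (R : ℝ) :
    MeasurableSet (logRegion A R) := (isClosed_logRegion A R).measurableSet

theorem exists_pos_le_of_forall_pos {ι : Type*} (s : Finset ι) (f : ι → ℝ)
    (hf : ∀ i ∈ s, 0 < f i) : ∃ c : ℝ, 0 < c ∧ ∀ i ∈ s, c ≤ f i := by
  rcases s.eq_empty_or_nonempty with rfl | hs
  · exact ⟨1, one_pos, by simp⟩
  · obtain ⟨i, hi, h⟩ := s.exists_min_image f hs
    exact ⟨f i, hf i hi, h⟩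

/-- If `(1, …, 1)` is interior to the cone, `(1, …, 1) ± δ v` are nonnegative combinations of `A`, which
bounds every linear form `⟨v, ξ⟩` on the region in terms of `R` and `∑ ξ_j`. -/
theorem exists_abs_dotProduct_le {A : Finset (Fin n → ℝ)} (hA : A.Nonempty)
    (h : diag n 1 ∈ interior (coneOf (convexHull ℝ (A : Set (Fin n → ℝ))))) (v : Fin n → ℝ) :
    ∃ δ M : ℝ, 0 < δ ∧ 0 < M ∧ ∀ R : ℝ, 0 ≤ R → ∀ ξ ∈ logRegion A R,
      ∑ j, ξ j + δ * |v ⬝ᵥ ξ| ≤ M * R := by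
  obtain ⟨ε, hε, hball⟩ := Metric.isOpen_iff.1 isOpen_interior _ h
  set δ : ℝ := ε / (‖v‖ + 1) / 2 with hδ
  have hδ0 : 0 < δ := by positivity
  have key : ∀ u : Fin n → ℝ, ‖u‖ = ‖v‖ → ∃ M : ℝ, 0 ≤ M ∧ ∀ R : ℝ, ∀ ξ ∈ logRegion A R,
      ∑ j, ξ j + δ * (u ⬝ᵥ ξ) ≤ M * R := by
    intro u hu
    have hmem : diag n 1 + δ • u ∈ coneOf (convexHull ℝ (A : Set (Fin n → ℝ))) := by
      refine interior_subset (hball ?_)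
      rw [Metric.mem_ball, dist_eq_norm, add_sub_cancel_left, norm_smul, Real.norm_eq_abs,
        abs_of_pos hδ0, hδ, div_div, hu, div_mul_eq_mul_div, div_lt_iff₀ (by positivity)]
      nlinarith [norm_nonneg v]
    obtain ⟨μ, hμ, hμe⟩ := (mem_coneOf_convexHull hA).1 hmem
    refine ⟨∑ α ∈ A, μ α, Finset.sum_nonneg fun α _ => hμ α, fun R ξ hξ => ?_⟩
    have h1 : (diag n 1 + δ • u) ⬝ᵥ ξ = ∑ j, ξ j + δ * (u ⬝ᵥ ξ) := by
      rw [add_dotProduct, diag_dotProduct, smul_dotProduct, one_mul, smul_eq_mul]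
    rw [← h1, hμe, sum_smul_dotProduct, Finset.sum_mul]
    exact Finset.sum_le_sum fun α hα => mul_le_mul_of_nonneg_left (hξ α hα) (hμ α)
  obtain ⟨M₁, hM₁, h₁⟩ := key v rfl
  obtain ⟨M₂, hM₂, h₂⟩ := key (-v) (norm_neg v)
  refine ⟨δ, M₁ + M₂ + 1, hδ0, by positivity, fun R hR ξ hξ => ?_⟩
  have e1 := h₁ R ξ hξ
  have e2 := h₂ R ξ hξ
  rw [neg_dotProduct] at e2
  have n1 := mul_nonneg hM₁ hR
  have n2 := mul_nonneg hM₂ hR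
  rcases abs_cases (v ⬝ᵥ ξ) with ⟨h, -⟩ | ⟨h, -⟩ <;> rw [h] <;> nlinarith

namespace IsComplementaryPair

variable {A : Finset (Fin n → ℝ)} {d : ℝ} {ξ₀ : Fin n → ℝ} {w : (Fin n → ℝ) → ℝ}

theorem sum_mul_dotProduct (h : IsComplementaryPair A d ξ₀ w) (ζ : Fin n → ℝ) :
    ∑ α ∈ A with α ⬝ᵥ ξ₀ = 1, w α * (α ⬝ᵥ ζ) = d * ∑ j, ζ j := by
  rw [← diag_dotProduct, ← h.sum_filter_smul, sum_smul_dotProduct]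

/-- Upper bound: on the region, `exp (∑ ξ_j - R θ)` is dominated by a product of exponentials
`exp (-κ_i |y_i|)`, where `κ_i` is constant for the active coordinates `i ∈ I` and of order `1 / R`
for the others; each of the latter contributes a factor of order `R` to the integral. -/
theorem exists_logVolume_le (h : IsComplementaryPair A d ξ₀ w) (hd : 0 < d)
    (hA : diag n 1 ∈ interior (coneOf (convexHull ℝ (A : Set (Fin n → ℝ)))))
    {b : Module.Basis (Fin n) ℝ (Fin n → ℝ)} {I : Finset (Fin n)}
    (hI : ∀ i ∈ I, b i ∈ A.filter fun α => α ⬝ᵥ ξ₀ = 1) :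
    ∃ K : ℝ, 0 < K ∧ ∀ R : ℝ, 1 ≤ R →
      logVolume A R ≤ ENNReal.ofReal (K * (Real.exp (R * ∑ j, ξ₀ j) * R ^ (Iᶜ).card)) := by
  classical
  have hAne : A.Nonempty := h.filter_nonempty.mono (Finset.filter_subset _ _)
  obtain ⟨J, hJ, hJint⟩ := exists_lintegral_basis_coord b
  set θ := ∑ j, ξ₀ j with hθ
  have hθ0 : 0 < θ := by
    have := h.mul_sum_eq_one
    by_contra hneg
    nlinarith
  obtain ⟨c, hc, hcw⟩ : ∃ c : ℝ, 0 < c ∧ ∀ i ∈ I, 2 * (c * d) ≤ w (b i) := by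
    obtain ⟨c, hc, hcw⟩ := exists_pos_le_of_forall_pos I (fun i => w (b i)) fun i hi =>
      h.pos _ (Finset.mem_filter.1 (hI i hi)).1 (Finset.mem_filter.1 (hI i hi)).2
    refine ⟨c / (2 * d), by positivity, fun i hi => ?_⟩
    have := hcw i hi
    have e : 2 * (c / (2 * d) * d) = c := by field_simp
    rwa [e]
  obtain ⟨C, hC, hCb⟩ : ∃ C : ℝ, 0 < C ∧ ∀ i, ∀ R : ℝ, 0 ≤ R → ∀ ξ ∈ logRegion A R,
      R * θ - ∑ j, ξ j ≥ 0 → |b i ⬝ᵥ (ξ - R • ξ₀)| ≤ C * (R + (R * θ - ∑ j, ξ j)) := by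
    have : ∀ i, ∃ C : ℝ, 0 < C ∧ ∀ R : ℝ, 0 ≤ R → ∀ ξ ∈ logRegion A R,
        R * θ - ∑ j, ξ j ≥ 0 → |b i ⬝ᵥ (ξ - R • ξ₀)| ≤ C * (R + (R * θ - ∑ j, ξ j)) := by
      intro i
      obtain ⟨δ, M, hδ, hM, hb⟩ := exists_abs_dotProduct_le hAne hA (b i)
      refine ⟨(M + 1) / δ + |b i ⬝ᵥ ξ₀|, by positivity, fun R hR ξ hξ hL => ?_⟩
      have h1 : |b i ⬝ᵥ ξ| ≤ (M + 1) / δ * (R + (R * θ - ∑ j, ξ j)) := by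
        rw [div_mul_eq_mul_div, le_div_iff₀ hδ]
        have := hb R hR ξ hξ
        have := mul_nonneg hM.le hL
        have := mul_nonneg hR hθ0.le
        nlinarith
      have h2 : |b i ⬝ᵥ (ξ - R • ξ₀)| ≤ |b i ⬝ᵥ ξ| + |b i ⬝ᵥ ξ₀| * R := by
        rw [dotProduct_sub, dotProduct_smul, smul_eq_mul]
        refine (abs_sub _ _).trans ?_
        rw [abs_mul, abs_of_nonneg hR, mul_comm R]
      have := mul_nonneg (abs_nonneg (b i ⬝ᵥ ξ₀)) hL
      nlinarith
    choose C hC hCb using this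
    refine ⟨∑ i, C i + 1, by have := Finset.sum_nonneg fun i (_ : i ∈ Finset.univ) => (hC i).le;
                             positivity, fun i R hR ξ hξ hL => (hCb i R hR ξ hξ hL).trans ?_⟩
    refine mul_le_mul_of_nonneg_right ?_ (by linarith)
    have := Finset.single_le_sum (fun i _ => (hC i).le) (Finset.mem_univ i)
    linarith
  -- With this `a`, the exponents `a |y_i| / R` of the at most `n` inactive coordinates add up to at
  -- most `(1 - ∑ ζ_j) / 2`, so half of the decay `exp (∑ ζ_j)` pays for them.
  set a : ℝ := 1 / (2 * ((n + 1) * C)) with ha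
  have ha0 : 0 < a := by positivity
  refine ⟨J * (Real.exp (1 / 2) * ((2 / c) ^ I.card * (2 / a) ^ (Iᶜ).card)), by positivity,
    fun R hR => ?_⟩
  have hR0 : 0 < R := by linarith
  set κ : Fin n → ℝ := fun i => if i ∈ I then c else a / R with hκ
  have hκ0 : ∀ i, 0 < κ i := fun i => by
    simp only [hκ]; split_ifs
    · exact hc
    · positivity
  have hpt : ∀ ξ ∈ logRegion A R, Real.exp (∑ j, ξ j) ≤ Real.exp (R * θ) * Real.exp (1 / 2) *
      Real.exp (-∑ i, κ i * |b i ⬝ᵥ (ξ - R • ξ₀)|) := by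
    intro ξ hξ
    rw [← Real.exp_add, ← Real.exp_add, Real.exp_le_exp]
    set ζ := ξ - R • ξ₀ with hζ
    have hζL : ∑ j, ζ j = ∑ j, ξ j - R * θ := by
      simp [hζ, hθ, Finset.mul_sum]
    have hact : ∀ α ∈ A.filter (fun α => α ⬝ᵥ ξ₀ = 1), α ⬝ᵥ ζ ≤ 0 := by
      intro α hα
      obtain ⟨hα1, hα2⟩ := Finset.mem_filter.1 hα
      rw [hζ, dotProduct_sub, dotProduct_smul, hα2, smul_eq_mul, mul_one]
      linarith [hξ α hα1]
    have hterm : ∀ α ∈ A.filter (fun α => α ⬝ᵥ ξ₀ = 1), w α * (α ⬝ᵥ ζ) ≤ 0 := fun α hα =>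
      mul_nonpos_of_nonneg_of_nonpos (h.nonneg α) (hact α hα)
    have hsum := h.sum_mul_dotProduct ζ
    have hL : ∑ j, ζ j ≤ 0 := by
      have := Finset.sum_nonpos hterm
      rw [hsum] at this
      by_contra hneg
      push Not at hneg
      have := mul_pos hd hneg
      linarith
    have hLI : ∑ j, ζ j ≤ 2 * ∑ i ∈ I, -(c * |b i ⬝ᵥ ζ|) := by
      have h1 : d * ∑ j, ζ j ≤ ∑ i ∈ I, w (b i) * (b i ⬝ᵥ ζ) := by
        rw [← hsum, ← Finset.sum_image (s := I) (g := b) (f := fun α => w α * (α ⬝ᵥ ζ))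
          (b.injective.injOn)]
        have hsub : I.image b ⊆ A.filter fun α => α ⬝ᵥ ξ₀ = 1 := by
          intro α hα
          obtain ⟨i, hi, rfl⟩ := Finset.mem_image.1 hα
          exact hI i hi
        rw [← Finset.sum_sdiff hsub]
        have := Finset.sum_nonpos fun α (hα : α ∈ (A.filter fun α => α ⬝ᵥ ξ₀ = 1) \ I.image b) =>
          hterm α (Finset.mem_sdiff.1 hα).1
        linarith
      have h2 : ∑ i ∈ I, w (b i) * (b i ⬝ᵥ ζ) ≤ d * (2 * ∑ i ∈ I, -(c * |b i ⬝ᵥ ζ|)) := by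
        rw [Finset.mul_sum, Finset.mul_sum]
        refine Finset.sum_le_sum fun i hi => ?_
        have hy := hact _ (hI i hi)
        rw [abs_of_nonpos hy]
        nlinarith [hcw i hi]
      exact le_of_mul_le_mul_left (h1.trans h2) hd
    have hout : ∑ i ∈ Iᶜ, a / R * |b i ⬝ᵥ ζ| ≤ (1 - ∑ j, ζ j) / 2 := by
      have h1 : ∀ i ∈ Iᶜ, a / R * |b i ⬝ᵥ ζ| ≤ a * (C * (1 - ∑ j, ζ j)) := by
        intro i _
        have := hCb i R hR0.le ξ hξ (by linarith)
        rw [← hζ] at this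
        have h3 : |b i ⬝ᵥ ζ| ≤ R * (C * (1 - ∑ j, ζ j)) := by
          have : R + (R * θ - ∑ j, ξ j) ≤ R * (1 - ∑ j, ζ j) := by nlinarith
          nlinarith
        calc a / R * |b i ⬝ᵥ ζ| ≤ a / R * (R * (C * (1 - ∑ j, ζ j))) := by gcongr
          _ = _ := by field_simp
      refine (Finset.sum_le_card_nsmul _ _ _ h1).trans ?_
      rw [nsmul_eq_mul]
      have hcard : (((Iᶜ).card : ℕ) : ℝ) ≤ n + 1 := by
        have := Finset.card_le_univ (Iᶜ)
        rw [Fintype.card_fin] at this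
        have : (((Iᶜ).card : ℕ) : ℝ) ≤ n := by exact_mod_cast this
        linarith
      calc (((Iᶜ).card : ℕ) : ℝ) * (a * (C * (1 - ∑ j, ζ j)))
          ≤ (n + 1) * (a * (C * (1 - ∑ j, ζ j))) := by
            refine mul_le_mul_of_nonneg_right hcard ?_
            have : 0 ≤ 1 - ∑ j, ζ j := by linarith
            positivity
        _ = _ := by rw [ha]; field_simp
    have hsplit : ∑ i, κ i * |b i ⬝ᵥ ζ| =
        ∑ i ∈ I, c * |b i ⬝ᵥ ζ| + ∑ i ∈ Iᶜ, a / R * |b i ⬝ᵥ ζ| := by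
      rw [← Finset.sum_add_sum_compl I]
      congr 1
      · exact Finset.sum_congr rfl fun i hi => by simp only [hκ, if_pos hi]
      · exact Finset.sum_congr rfl fun i hi => by
          simp only [hκ, if_neg (Finset.mem_compl.1 hi)]
    rw [Finset.sum_neg_distrib] at hLI
    rw [hsplit]
    linarith
  have hprod : ∏ i, 2 / κ i = (2 / c) ^ I.card * ((2 / a) ^ (Iᶜ).card * R ^ (Iᶜ).card) := by
    rw [← Finset.prod_mul_prod_compl I]
    congr 1
    · exact Finset.prod_eq_pow_card fun i hi => by simp only [hκ, if_pos hi]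
    · rw [← mul_pow]
      refine Finset.prod_eq_pow_card fun i hi => ?_
      simp only [hκ, if_neg (Finset.mem_compl.1 hi)]
      field_simp
  have hmeas : Measurable fun y : Fin n → ℝ => ENNReal.ofReal (Real.exp (-∑ i, κ i * |y i|)) := by
    fun_prop
  calc logVolume A R
      ≤ ∫⁻ ξ in logRegion A R, ENNReal.ofReal (Real.exp (R * θ) * Real.exp (1 / 2)) *
          ENNReal.ofReal (Real.exp (-∑ i, κ i * |b i ⬝ᵥ (ξ - R • ξ₀)|)) := by
        refine setLIntegral_mono' (measurableSet_logRegion A R) fun ξ hξ => ?_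
        rw [← ENNReal.ofReal_mul (by positivity)]
        exact ENNReal.ofReal_le_ofReal (hpt ξ hξ)
    _ ≤ ∫⁻ ξ, ENNReal.ofReal (Real.exp (R * θ) * Real.exp (1 / 2)) *
          ENNReal.ofReal (Real.exp (-∑ i, κ i * |b i ⬝ᵥ (ξ - R • ξ₀)|)) :=
        setLIntegral_le_lintegral _ _
    _ = ENNReal.ofReal (Real.exp (R * θ) * Real.exp (1 / 2)) *
          (ENNReal.ofReal J * ENNReal.ofReal (∏ i, 2 / κ i)) := by
        rw [lintegral_const_mul' _ _ ENNReal.ofReal_ne_top, hJint (R • ξ₀) _ hmeas,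
          lintegral_exp_neg_sum_mul_abs hκ0]
    _ = _ := by
        rw [← ENNReal.ofReal_mul hJ.le, ← ENNReal.ofReal_mul (by positivity), hprod]
        congr 1
        ring

/-- Lower bound: the region contains a box with `y_i` close to `-1` for the active coordinates `i ∈ I` and
`|y_i| ≤ c R` for the others. The point with all active `y_i = -1` and all others `0` pairs to `-1`
with every active exponent, so the active constraints hold with room; the inactive ones have slack of
order `R`. -/
theorem exists_le_logVolume (h : IsComplementaryPair A d ξ₀ w) (hd : 0 < d)
    {b : Module.Basis (Fin n) ℝ (Fin n → ℝ)} {I : Finset (Fin n)}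
    (hI : ∀ i ∈ I, b i ∈ A.filter fun α => α ⬝ᵥ ξ₀ = 1)
    (hrepr : ∀ α ∈ A, α ⬝ᵥ ξ₀ = 1 → ∀ j ∉ I, b.repr α j = 0) :
    ∃ K R₀ : ℝ, 0 < K ∧ 0 < R₀ ∧ ∀ R : ℝ, R₀ ≤ R →
      ENNReal.ofReal (K * (Real.exp (R * ∑ j, ξ₀ j) * R ^ (Iᶜ).card)) ≤ logVolume A R := by
  classical
  obtain ⟨J, hJ, hJint⟩ := exists_lintegral_basis_coord b
  set θ := ∑ j, ξ₀ j with hθ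
  obtain ⟨δ, hδ, hδA⟩ := exists_pos_le_of_forall_pos (A.filter fun α => α ⬝ᵥ ξ₀ ≠ 1)
    (fun α => 1 - α ⬝ᵥ ξ₀) fun α hα => by
      obtain ⟨h1, h2⟩ := Finset.mem_filter.1 hα
      exact sub_pos.2 (lt_of_le_of_ne (h.le_one α h1) h2)
  obtain ⟨B, hB1, hB⟩ : ∃ B : ℝ, 1 ≤ B ∧ ∀ α ∈ A, ∑ i, |b.repr α i| ≤ B := by
    have hnn : ∀ α ∈ A, 0 ≤ ∑ i, |b.repr α i| := fun α _ =>
      Finset.sum_nonneg fun i _ => abs_nonneg _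
    refine ⟨∑ α ∈ A, ∑ i, |b.repr α i| + 1, ?_, fun α hα => ?_⟩
    · linarith [Finset.sum_nonneg hnn]
    · linarith [Finset.single_le_sum hnn hα]
  have hB0 : 0 < B := by linarith
  set c : ℝ := δ / (2 * B) with hc
  have hc0 : 0 < c := by positivity
  have hexpand : ∀ α ζ : Fin n → ℝ, α ⬝ᵥ ζ = ∑ i, b.repr α i * (b i ⬝ᵥ ζ) := fun α ζ => by
    conv_lhs => rw [← b.sum_repr α, sum_dotProduct]
    simp [smul_dotProduct]
  refine ⟨Real.exp (-(2 * θ)) * (J * ((2 / B) ^ I.card * (2 * c) ^ (Iᶜ).card)), 4 * B / δ,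
    by positivity, by positivity, fun R hR => ?_⟩
  have hR0 : 0 < R := lt_of_lt_of_le (by positivity) hR
  have hRB : 4 * B ≤ R * δ := (div_le_iff₀ hδ).1 hR
  set lo : Fin n → ℝ := fun i => if i ∈ I then -1 - 1 / B else -(c * R) with hlo
  set hi : Fin n → ℝ := fun i => if i ∈ I then -1 + 1 / B else c * R with hhi
  have hB1' : 1 / B ≤ 1 := by rw [div_le_one hB0]; exact hB1
  have hbox : ∀ y ∈ Set.Icc lo hi, (∀ i ∈ I, |y i + 1| ≤ 1 / B) ∧ ∀ i, |y i| ≤ 2 + c * R := by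
    rintro y ⟨hy1, hy2⟩
    have hcR : 0 < c * R := by positivity
    have hin : ∀ i ∈ I, |y i + 1| ≤ 1 / B := fun i hiI => by
      have e1 := hy1 i
      have e2 := hy2 i
      simp only [hlo, hhi, if_pos hiI] at e1 e2
      rw [abs_le]
      constructor <;> linarith
    refine ⟨hin, fun i => ?_⟩
    by_cases hiI : i ∈ I
    · have := abs_le.1 (hin i hiI)
      rw [abs_le]
      constructor <;> linarith
    · have e1 := hy1 i
      have e2 := hy2 i
      simp only [hlo, hhi, if_neg hiI] at e1 e2
      rw [abs_le]
      constructor <;> linarith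
  have hsub : ∀ ξ : Fin n → ℝ, (fun i => b i ⬝ᵥ (ξ - R • ξ₀)) ∈ Set.Icc lo hi →
      ξ ∈ logRegion A R ∧ R * θ + -(2 * θ) ≤ ∑ j, ξ j := by
    intro ξ hξ
    obtain ⟨hin, hall⟩ := hbox _ hξ
    set ζ := ξ - R • ξ₀ with hζ
    have hαξ : ∀ α : Fin n → ℝ, α ⬝ᵥ ξ = α ⬝ᵥ ζ + R * (α ⬝ᵥ ξ₀) := fun α => by
      rw [hζ, dotProduct_sub, dotProduct_smul, smul_eq_mul]; ring
    have hact : ∀ α ∈ A, α ⬝ᵥ ξ₀ = 1 → |α ⬝ᵥ ζ + 1| ≤ 1 := by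
      intro α hα h1
      have e : α ⬝ᵥ ζ + 1 = ∑ i, b.repr α i * (b i ⬝ᵥ ζ + b i ⬝ᵥ ξ₀) := by
        simp only [mul_add, Finset.sum_add_distrib]
        rw [← hexpand, ← hexpand, h1]
      rw [e]
      calc |∑ i, b.repr α i * (b i ⬝ᵥ ζ + b i ⬝ᵥ ξ₀)|
          ≤ ∑ i, |b.repr α i * (b i ⬝ᵥ ζ + b i ⬝ᵥ ξ₀)| := Finset.abs_sum_le_sum_abs _ _
        _ ≤ ∑ i, |b.repr α i| * (1 / B) := by
          refine Finset.sum_le_sum fun i _ => ?_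
          rw [abs_mul]
          by_cases hiI : i ∈ I
          · have := hin i hiI
            rw [(Finset.mem_filter.1 (hI i hiI)).2]
            gcongr
          · rw [hrepr α hα h1 i hiI]; simp
        _ ≤ B * (1 / B) := by
          rw [← Finset.sum_mul]
          exact mul_le_mul_of_nonneg_right (hB α hα) (by positivity)
        _ = 1 := by field_simp
    constructor
    · intro α hα
      rw [hαξ]
      by_cases h1 : α ⬝ᵥ ξ₀ = 1
      · have := abs_le.1 (hact α hα h1)
        rw [h1]
        linarith
      · have e1 : α ⬝ᵥ ζ ≤ B * (2 + c * R) := by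
          rw [hexpand]
          calc ∑ i, b.repr α i * (b i ⬝ᵥ ζ) ≤ ∑ i, |b.repr α i| * (2 + c * R) := by
                refine Finset.sum_le_sum fun i _ => (le_abs_self _).trans ?_
                rw [abs_mul]
                exact mul_le_mul_of_nonneg_left (hall i) (abs_nonneg _)
            _ ≤ _ := by
                rw [← Finset.sum_mul]
                exact mul_le_mul_of_nonneg_right (hB α hα) (by positivity)
        have e2 : B * (c * R) = δ * R / 2 := by rw [hc]; field_simp
        have e3 : δ ≤ 1 - α ⬝ᵥ ξ₀ := hδA α (Finset.mem_filter.2 ⟨hα, h1⟩)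
        nlinarith
    · have e1 : ∑ j, ξ j = ∑ j, ζ j + R * θ := by simp [hζ, hθ, Finset.mul_sum]
      have e2 : -2 ≤ d * ∑ j, ζ j := by
        rw [← h.sum_mul_dotProduct ζ]
        have : (-2 : ℝ) = ∑ α ∈ A with α ⬝ᵥ ξ₀ = 1, w α * (-2) := by
          rw [← Finset.sum_mul, h.sum_filter_eq_one, one_mul]
        rw [this]
        refine Finset.sum_le_sum fun α hα => mul_le_mul_of_nonneg_left ?_ (h.nonneg α)
        obtain ⟨hα1, hα2⟩ := Finset.mem_filter.1 hα
        have := abs_le.1 (hact α hα1 hα2)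
        linarith
      have e3 := h.mul_sum_eq_one
      rw [← hθ] at e3
      have e4 : d * (-(2 * θ)) ≤ d * ∑ j, ζ j := by nlinarith
      have := le_of_mul_le_mul_left e4 hd
      linarith
  have hvol : volume (Set.Icc lo hi) =
      ENNReal.ofReal ((2 / B) ^ I.card * ((2 * c) ^ (Iᶜ).card * R ^ (Iᶜ).card)) := by
    rw [Real.volume_Icc_pi, ← ENNReal.ofReal_prod_of_nonneg]
    · congr 1
      rw [← Finset.prod_mul_prod_compl I]
      congr 1
      · refine Finset.prod_eq_pow_card fun i hiI => ?_
        simp only [hlo, hhi, if_pos hiI]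
        ring
      · rw [← mul_pow]
        refine Finset.prod_eq_pow_card fun i hiI => ?_
        simp only [hlo, hhi, if_neg (Finset.mem_compl.1 hiI)]
        ring
    · intro i _
      have : 0 < 1 / B := by positivity
      have : 0 < c * R := by positivity
      simp only [hlo, hhi]
      split_ifs <;> linarith
  calc ENNReal.ofReal (Real.exp (-(2 * θ)) * (J * ((2 / B) ^ I.card * (2 * c) ^ (Iᶜ).card)) *
        (Real.exp (R * θ) * R ^ (Iᶜ).card))
      = ENNReal.ofReal (Real.exp (R * θ + -(2 * θ))) *
          ∫⁻ ξ, (Set.Icc lo hi).indicator 1 (fun i => b i ⬝ᵥ (ξ - R • ξ₀)) := by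
        rw [hJint (R • ξ₀) _ (measurable_one.indicator measurableSet_Icc),
          lintegral_indicator_one measurableSet_Icc, hvol, ← ENNReal.ofReal_mul hJ.le,
          ← ENNReal.ofReal_mul (by positivity), Real.exp_add]
        congr 1
        ring
    _ = ∫⁻ ξ, ENNReal.ofReal (Real.exp (R * θ + -(2 * θ))) *
          (Set.Icc lo hi).indicator 1 (fun i => b i ⬝ᵥ (ξ - R • ξ₀)) :=
        (lintegral_const_mul' _ _ ENNReal.ofReal_ne_top).symm
    _ ≤ ∫⁻ ξ, (logRegion A R).indicator (fun ξ => ENNReal.ofReal (Real.exp (∑ j, ξ j))) ξ := by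
        refine lintegral_mono fun ξ => ?_
        by_cases hξ : (fun i => b i ⬝ᵥ (ξ - R • ξ₀)) ∈ Set.Icc lo hi
        · obtain ⟨h1, h2⟩ := hsub ξ hξ
          simp only [Set.indicator_of_mem hξ, Set.indicator_of_mem h1, Pi.one_apply, mul_one]
          exact ENNReal.ofReal_le_ofReal (Real.exp_le_exp.2 h2)
        · simp only [Set.indicator_of_notMem hξ, mul_zero]
          exact zero_le
    _ = logVolume A R := lintegral_indicator (measurableSet_logRegion A R) _

end IsComplementaryPair

/-! ### Recession directions and exponential coordinates -/

/-- The region contains the disjoint balls of radius `ε` around the points `2 k ε η / ‖η‖`, `k ∈ ℕ`, and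
the integrand is bounded below on all of them. -/
theorem logVolume_eq_top {A : Finset (Fin n → ℝ)} {η : Fin n → ℝ} (hη : η ≠ 0)
    (hA : ∀ α ∈ A, α ⬝ᵥ η ≤ 0) (hsum : 0 ≤ ∑ j, η j) {R : ℝ} (hR : 0 < R) :
    logVolume A R = ⊤ := by
  have hnhds : logRegion A R ∈ 𝓝 (0 : Fin n → ℝ) := by
    have : logRegion A R = ⋂ α ∈ A, {ξ | α ⬝ᵥ ξ ≤ R} := by ext; simp [logRegion]
    rw [this, Filter.biInter_finset_mem]
    intro α _
    have hc : Continuous fun ξ : Fin n → ℝ => α ⬝ᵥ ξ := by unfold dotProduct; fun_prop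
    refine mem_of_superset ((isOpen_lt hc continuous_const).mem_nhds
      (show (0 : Fin n → ℝ) ∈ {ξ | α ⬝ᵥ ξ < R} by simpa using hR)) fun ξ hξ => ?_
    exact (show α ⬝ᵥ ξ < R from hξ).le
  obtain ⟨ε, hε, hball⟩ := Metric.mem_nhds_iff.1 hnhds
  have hηn : 0 < ‖η‖ := norm_pos_iff.2 hη
  set s : ℝ := 2 * ε / ‖η‖ with hs
  have hs0 : 0 < s := by positivity
  let Q : ℕ → Set (Fin n → ℝ) := fun k => Metric.ball ((k * s) • η) ε
  have hQ : ∀ k, ∀ ξ ∈ Q k, ξ ∈ logRegion A R ∧ -(n * ε) ≤ ∑ j, ξ j := by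
    intro k ξ hξ
    set ζ := ξ - (k * s) • η with hζ
    have hζn : ‖ζ‖ < ε := by rw [hζ, ← dist_eq_norm]; exact hξ
    have hξe : ξ = ζ + (k * s) • η := by rw [hζ]; abel
    have hks : 0 ≤ k * s := by positivity
    constructor
    · intro α hα
      have h1 : α ⬝ᵥ ζ ≤ R := hball (by simpa using hζn : ζ ∈ Metric.ball 0 ε) α hα
      rw [hξe, dotProduct_add, dotProduct_smul, smul_eq_mul]
      linarith [mul_nonpos_of_nonneg_of_nonpos hks (hA α hα)]
    · have h1 : ∑ j, ξ j = ∑ j, ζ j + k * s * ∑ j, η j := by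
        rw [hξe]; simp [Finset.sum_add_distrib, Finset.mul_sum]
      have h2 : ∑ _j : Fin n, (-ε) ≤ ∑ j, ζ j := Finset.sum_le_sum fun j _ => by
        have := (abs_le.1 ((norm_le_pi_norm ζ j).trans hζn.le)).1
        exact this
      rw [Finset.sum_const, Finset.card_univ, Fintype.card_fin, nsmul_eq_mul] at h2
      have := mul_nonneg hks hsum
      linarith
  have hdisj : Pairwise (Function.onFun Disjoint Q) := by
    intro k l hkl
    refine Metric.ball_disjoint_ball ?_
    rw [dist_eq_norm, ← sub_smul, norm_smul, Real.norm_eq_abs, ← sub_mul, abs_mul, abs_of_pos hs0,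
      mul_assoc, hs, div_mul_cancel₀ _ hηn.ne']
    have : (1 : ℝ) ≤ |(k : ℝ) - l| := by
      have h1 : (k : ℤ) - l ≠ 0 := by omega
      have h2 := Int.one_le_abs h1
      have h3 : ((1 : ℤ) : ℝ) ≤ ((|(k : ℤ) - l| : ℤ) : ℝ) := by exact_mod_cast h2
      simpa using h3
    nlinarith
  set c : ENNReal := ENNReal.ofReal (Real.exp (-(n * ε))) * volume (Metric.ball (0 : Fin n → ℝ) ε)
    with hc
  have hc0 : c ≠ 0 := by
    refine mul_ne_zero ?_ (Metric.measure_ball_pos volume _ hε).ne'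
    rw [ENNReal.ofReal_ne_zero_iff]
    exact Real.exp_pos _
  have hint : ∀ k, c ≤ ∫⁻ ξ in Q k, ENNReal.ofReal (Real.exp (∑ j, ξ j)) := by
    intro k
    have h1 : c = ∫⁻ _ξ in Q k, ENNReal.ofReal (Real.exp (-(n * ε))) := by
      rw [setLIntegral_const, hc, ← Measure.addHaar_ball_center volume ((k * s) • η) ε]
    rw [h1]
    refine setLIntegral_mono' measurableSet_ball fun ξ hξ => ?_
    exact ENNReal.ofReal_le_ofReal (Real.exp_le_exp.2 (hQ k ξ hξ).2)
  rw [eq_top_iff]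
  calc ⊤ = ∑' _k : ℕ, c := (ENNReal.tsum_const_eq_top_of_ne_zero hc0).symm
    _ ≤ ∑' k, ∫⁻ ξ in Q k, ENNReal.ofReal (Real.exp (∑ j, ξ j)) := ENNReal.tsum_le_tsum hint
    _ = ∫⁻ ξ in ⋃ k, Q k, ENNReal.ofReal (Real.exp (∑ j, ξ j)) :=
        (lintegral_iUnion (fun _ => measurableSet_ball) hdisj _).symm
    _ ≤ logVolume A R :=
        lintegral_mono_set (Set.iUnion_subset fun k ξ hξ => (hQ k ξ hξ).1)

/-- The point `(σ_j exp ξ_j)_j`. For a sign vector `σ` this parametrizes an open orthant. -/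
noncomputable def signedExp (σ ξ : Fin n → ℝ) : Fin n → ℝ := fun j => σ j * Real.exp (ξ j)

theorem volume_image_signedExp {σ : Fin n → ℝ} (hσ : ∀ j, |σ j| = 1) {D : Set (Fin n → ℝ)}
    (hD : MeasurableSet D) :
    volume (signedExp σ '' D) = ∫⁻ ξ in D, ENNReal.ofReal (Real.exp (∑ j, ξ j)) := by
  have hσ0 : ∀ j, σ j ≠ 0 := fun j h => by have := hσ j; simp [h] at this
  let f' : (Fin n → ℝ) → (Fin n → ℝ) →L[ℝ] (Fin n → ℝ) := fun ξ =>
    ContinuousLinearMap.pi fun j => (σ j * Real.exp (ξ j)) • ContinuousLinearMap.proj j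
  have hderiv : ∀ ξ ∈ D, HasFDerivWithinAt (signedExp σ) (f' ξ) D ξ := by
    intro ξ _
    refine HasFDerivAt.hasFDerivWithinAt (hasFDerivAt_pi.2 fun j => ?_)
    have h1 : HasFDerivAt (fun ξ : Fin n → ℝ => ξ j) (ContinuousLinearMap.proj j) ξ :=
      (ContinuousLinearMap.proj (R := ℝ) (φ := fun _ : Fin n => ℝ) j).hasFDerivAt
    have h2 := (h1.exp).const_mul (σ j)
    rwa [smul_smul] at h2
  have hinj : Set.InjOn (signedExp σ) D := fun ξ _ ξ' _ h => by
    ext j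
    have := congrFun h j
    simp only [signedExp] at this
    exact Real.exp_injective (mul_left_cancel₀ (hσ0 j) this)
  have hdet : ∀ ξ, |(f' ξ).det| = Real.exp (∑ j, ξ j) := by
    intro ξ
    have h1 : ((f' ξ : (Fin n → ℝ) →L[ℝ] (Fin n → ℝ)) : (Fin n → ℝ) →ₗ[ℝ] (Fin n → ℝ)) =
        Matrix.toLin' (Matrix.diagonal fun j => σ j * Real.exp (ξ j)) := by
      ext v j
      simp [f', Matrix.mulVec_diagonal]
    rw [ContinuousLinearMap.det, h1, LinearMap.det_toLin', Matrix.det_diagonal, Finset.abs_prod,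
      Real.exp_sum]
    exact Finset.prod_congr rfl fun j _ => by rw [abs_mul, hσ, one_mul, Real.abs_exp]
  rw [← lintegral_abs_det_fderiv_eq_addHaar_image volume hD hderiv hinj]
  simp only [hdet]

/-- The union of the supports of the `f i`. -/
def jointSupport (f : Fin m → MvPolynomial (Fin n) ℝ) : Finset (Fin n →₀ ℕ) :=
  Finset.univ.biUnion fun i => (f i).support

open Classical in
/-- The exponents of the `f i`, as points of `ℝⁿ`; their convex hull is the Newton polyhedron. -/
noncomputable def exponentPoints (f : Fin m → MvPolynomial (Fin n) ℝ) : Finset (Fin n → ℝ) :=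
  (jointSupport f).image expPoint

theorem mem_jointSupport {f : Fin m → MvPolynomial (Fin n) ℝ} {i : Fin m} {α : Fin n →₀ ℕ}
    (h : α ∈ (f i).support) : α ∈ jointSupport f :=
  Finset.mem_biUnion.2 ⟨i, Finset.mem_univ i, h⟩

theorem newtonPolyhedron_eq (f : Fin m → MvPolynomial (Fin n) ℝ) :
    newtonPolyhedron f = convexHull ℝ (exponentPoints f : Set (Fin n → ℝ)) := by
  classical
  rw [newtonPolyhedron]
  congr 1
  ext x
  simp only [exponentPoints, jointSupport, Finset.coe_image, Finset.coe_biUnion, Finset.coe_univ,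
    Set.mem_univ, Set.iUnion_true, Set.image_iUnion]

theorem eval_monomial_signedExp (σ ξ : Fin n → ℝ) (α : Fin n →₀ ℕ) (a : ℝ) :
    MvPolynomial.eval (signedExp σ ξ) (MvPolynomial.monomial α a) =
      a * (∏ j, σ j ^ α j) * Real.exp (expPoint α ⬝ᵥ ξ) := by
  rw [MvPolynomial.eval_monomial, Finsupp.prod_fintype _ _ (fun i => pow_zero _)]
  simp only [signedExp, mul_pow, Finset.prod_mul_distrib, dotProduct, expPoint, Real.exp_sum,
    Real.exp_nat_mul]
  ring

theorem eval_signedExp (σ ξ : Fin n → ℝ) (p : MvPolynomial (Fin n) ℝ) :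
    MvPolynomial.eval (signedExp σ ξ) p =
      ∑ α ∈ p.support, p.coeff α * (∏ j, σ j ^ α j) * Real.exp (expPoint α ⬝ᵥ ξ) := by
  conv_lhs => rw [p.as_sum, map_sum]
  exact Finset.sum_congr rfl fun α _ => eval_monomial_signedExp σ ξ α _

theorem exists_abs_eval_le (f : Fin m → MvPolynomial (Fin n) ℝ) :
    ∃ C : ℝ, 0 < C ∧ ∀ (t : ℝ), ∀ ξ ∈ logRegion (exponentPoints f) t, ∀ i,
      |MvPolynomial.eval (signedExp 1 ξ) (f i)| ≤ C * Real.exp t := by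
  classical
  have hnn : ∀ i, 0 ≤ ∑ α ∈ (f i).support, |(f i).coeff α| := fun i =>
    Finset.sum_nonneg fun _ _ => abs_nonneg _
  refine ⟨∑ i, ∑ α ∈ (f i).support, |(f i).coeff α| + 1, ?_, fun t ξ hξ i => ?_⟩
  · have := Finset.sum_nonneg fun i (_ : i ∈ Finset.univ) => hnn i
    positivity
  · rw [eval_signedExp]
    have h1 := Finset.single_le_sum (fun i _ => hnn i) (Finset.mem_univ i)
    calc _ ≤ ∑ α ∈ (f i).support, |(f i).coeff α| * Real.exp t := by
          refine (Finset.abs_sum_le_sum_abs _ _).trans (Finset.sum_le_sum fun α hα => ?_)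
          simp only [Pi.one_apply, one_pow, Finset.prod_const_one, mul_one]
          rw [abs_mul, Real.abs_exp]
          gcongr
          exact hξ _ (Finset.mem_image_of_mem _ (mem_jointSupport hα))
      _ ≤ _ := by
          rw [← Finset.sum_mul]
          refine mul_le_mul_of_nonneg_right ?_ (Real.exp_pos t).le
          linarith

theorem exists_generalized_inverse {V W : Type*} [AddCommGroup V] [Module ℝ V] [AddCommGroup W]
    [Module ℝ W] (P : V →ₗ[ℝ] W) : ∃ g : W →ₗ[ℝ] V, ∀ x, P (g (P x)) = P x := by
  obtain ⟨h, hh⟩ := P.rangeRestrict.exists_rightInverse_of_surjective P.range_rangeRestrict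
  obtain ⟨g, hg⟩ := h.exists_extend
  refine ⟨g, fun x => ?_⟩
  have h1 : g (P x) = h (P.rangeRestrict x) := by rw [← hg]; rfl
  have h2 := LinearMap.congr_fun hh (P.rangeRestrict x)
  rw [h1]
  exact congrArg Subtype.val h2

/-! ### The Mikhailov–Gindikin condition as a lower bound -/

theorem exists_tendsto_ultrafilter {ι : Type*} (U : Ultrafilter ι) {u : ι → ℝ}
    (hu : ∀ k, u k ∈ Set.Icc (0 : ℝ) 1) : ∃ v ∈ Set.Icc (0 : ℝ) 1, Tendsto u U (𝓝 v) := by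
  obtain ⟨v, hv, h⟩ := isCompact_Icc.ultrafilter_le_nhds' (U.map u)
    (Filter.Eventually.of_forall hu : ∀ᶠ k in (U : Filter ι), u k ∈ Set.Icc (0 : ℝ) 1)
  exact ⟨v, hv, h⟩

/-- Limits of normalized monomial vectors `(exp ⟨α, ξ_k⟩)_α`: a limit `v` is supported on the points of
`A` where a linear form `η` is maximal, and there it is proportional to the monomial vector of some
`ζ`. With `P` the pairing with the differences `α - β`, `v α > 0`, the points `P ξ_k` converge. If `g` is
a generalized inverse of `P`, then `ζ` is the limit of `g (P ξ_k)`, and `η` is `ξ_k - g (P ξ_k)` for a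
large `k`. -/
theorem exists_face_of_tendsto {ι : Type*} {l : Filter ι} [l.NeBot] {A : Finset (Fin n → ℝ)}
    {ξ : ι → Fin n → ℝ} {s : ι → ℝ} (hs : ∀ k, 0 < s k) {v : (Fin n → ℝ) → ℝ}
    (hv0 : ∀ α ∈ A, 0 ≤ v α)
    (hv : ∀ α ∈ A, Tendsto (fun k => Real.exp (α ⬝ᵥ ξ k) / s k) l (𝓝 (v α)))
    {β : Fin n → ℝ} (hβ : β ∈ A) (hvβ : 0 < v β) :
    ∃ η ζ : Fin n → ℝ, (∀ α ∈ A, α ⬝ᵥ η ≤ β ⬝ᵥ η) ∧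
      (∀ α ∈ A, α ⬝ᵥ η = β ⬝ᵥ η → Real.exp (α ⬝ᵥ ζ) = Real.exp (β ⬝ᵥ ζ) / v β * v α) ∧
      (∀ α ∈ A, α ⬝ᵥ η ≠ β ⬝ᵥ η → v α = 0) := by
  classical
  have hratio : ∀ α ∈ A, Tendsto (fun k => Real.exp ((α - β) ⬝ᵥ ξ k)) l (𝓝 (v α / v β)) := by
    intro α hα
    refine ((hv α hα).div (hv β hβ) hvβ.ne').congr fun k => ?_
    rw [sub_dotProduct, Real.exp_sub]
    have := (hs k).ne'
    simp only [Pi.div_apply]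
    field_simp
  set S := A.filter fun α => 0 < v α with hS
  let P : (Fin n → ℝ) →ₗ[ℝ] (S → ℝ) :=
    Matrix.mulVecLin (Matrix.of fun α : S => (α : Fin n → ℝ) - β)
  have hP : ∀ x (α : S), P x α = ((α : Fin n → ℝ) - β) ⬝ᵥ x := fun x α => rfl
  obtain ⟨g, hg⟩ := exists_generalized_inverse P
  have hgc : Continuous g := LinearMap.continuous_of_finiteDimensional g
  have hPc : Continuous P := LinearMap.continuous_of_finiteDimensional P
  set c : S → ℝ := fun α => Real.log (v α / v β) with hc
  have hPlim : Tendsto (fun k => P (ξ k)) l (𝓝 c) := by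
    rw [tendsto_pi_nhds]
    intro α
    have h1 := hratio α (Finset.mem_filter.1 α.2).1
    have h2 := h1.log (div_pos (Finset.mem_filter.1 α.2).2 hvβ).ne'
    simp only [Real.log_exp] at h2
    exact h2
  have hglim : Tendsto (fun k => g (P (ξ k))) l (𝓝 (g c)) := (hgc.tendsto c).comp hPlim
  have hPgc : P (g c) = c := by
    refine tendsto_nhds_unique (((hPc.comp hgc).tendsto c).comp hPlim) ?_
    refine hPlim.congr fun k => ?_
    exact (hg (ξ k)).symm
  have hneg : ∀ α ∈ A, v α = 0 → ∀ᶠ k in l, (α - β) ⬝ᵥ (ξ k - g (P (ξ k))) < 0 := by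
    intro α hα h0
    have h1 := hratio α hα
    rw [h0, zero_div] at h1
    have hcont : Continuous fun x : Fin n → ℝ => Real.exp (-((α - β) ⬝ᵥ x)) := by
      unfold dotProduct; fun_prop
    have h2 := h1.mul ((hcont.tendsto _).comp hglim)
    rw [zero_mul] at h2
    filter_upwards [h2.eventually (gt_mem_nhds one_pos)] with k hk
    simp only [Function.comp_apply] at hk
    rw [← Real.exp_add, Real.exp_lt_one_iff] at hk
    rw [dotProduct_sub]
    linarith
  have hall : ∀ᶠ k in l, ∀ α ∈ A, v α = 0 → (α - β) ⬝ᵥ (ξ k - g (P (ξ k))) < 0 := by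
    rw [Filter.eventually_all_finset]
    intro α hα
    by_cases h0 : v α = 0
    · filter_upwards [hneg α hα h0] with k hk _ using hk
    · exact Eventually.of_forall fun k h => absurd h h0
  obtain ⟨k, hk⟩ := hall.exists
  set η := ξ k - g (P (ξ k)) with hη
  have hSη : ∀ α ∈ A, 0 < v α → α ⬝ᵥ η = β ⬝ᵥ η := by
    intro α hα h0
    have h1 : P η = 0 := by rw [hη, map_sub, hg, sub_self]
    have h2 := congrFun h1 ⟨α, Finset.mem_filter.2 ⟨hα, h0⟩⟩
    rw [hP, sub_dotProduct] at h2
    exact sub_eq_zero.1 h2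
  have hoff : ∀ α ∈ A, v α = 0 → α ⬝ᵥ η < β ⬝ᵥ η := by
    intro α hα h0
    have := hk α hα h0
    rw [sub_dotProduct] at this
    linarith
  refine ⟨η, g c, fun α hα => ?_, fun α hα h1 => ?_, fun α hα h1 => ?_⟩
  · rcases (hv0 α hα).eq_or_lt with h0 | h0
    · exact (hoff α hα h0.symm).le
    · exact (hSη α hα h0).le
  · have h0 : 0 < v α := lt_of_le_of_ne (hv0 α hα) fun h0 => (hoff α hα h0.symm).ne h1
    have h2 := congrFun hPgc ⟨α, Finset.mem_filter.2 ⟨hα, h0⟩⟩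
    rw [hP, sub_dotProduct] at h2
    simp only [hc] at h2
    have h3 : α ⬝ᵥ g c = β ⬝ᵥ g c + Real.log (v α / v β) := by linarith
    rw [h3, Real.exp_add, Real.exp_log (div_pos h0 hvβ)]
    ring
  · by_contra hne
    exact h1 (hSη α hα (lt_of_le_of_ne (hv0 α hα) (Ne.symm hne)))

/-- Under the Mikhailov–Gindikin condition `max_i |f_i|` dominates, up to a constant, every monomial
`x^α` with `α` an exponent of `f`, on each open orthant. -/
theorem MikhailovGindikin.exists_le_abs_eval {f : Fin m → MvPolynomial (Fin n) ℝ}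
    (hf : MikhailovGindikin f) (hne : (exponentPoints f).Nonempty) {σ : Fin n → ℝ}
    (hσ : ∀ j, σ j ≠ 0) :
    ∃ c : ℝ, 0 < c ∧ ∀ ξ : Fin n → ℝ, ∃ i, ∀ α ∈ exponentPoints f,
      c * Real.exp (α ⬝ᵥ ξ) ≤ |MvPolynomial.eval (signedExp σ ξ) (f i)| := by
  classical
  set A := exponentPoints f with hA
  set s : (Fin n → ℝ) → ℝ := fun ξ => ∑ α ∈ A, Real.exp (α ⬝ᵥ ξ) with hs
  have hs0 : ∀ ξ, 0 < s ξ := fun ξ => Finset.sum_pos (fun _ _ => Real.exp_pos _) hne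
  have hle : ∀ ξ, ∀ α ∈ A, Real.exp (α ⬝ᵥ ξ) ≤ s ξ := fun ξ α hα =>
    Finset.single_le_sum (f := fun α : Fin n → ℝ => Real.exp (α ⬝ᵥ ξ))
      (fun _ _ => (Real.exp_pos _).le) hα
  suffices h : ∃ c : ℝ, 0 < c ∧ ∀ ξ : Fin n → ℝ, ∃ i,
      c * s ξ ≤ |MvPolynomial.eval (signedExp σ ξ) (f i)| by
    obtain ⟨c, hc, h⟩ := h
    refine ⟨c, hc, fun ξ => ?_⟩
    obtain ⟨i, hi⟩ := h ξ
    exact ⟨i, fun α hα => (mul_le_mul_of_nonneg_left (hle ξ α hα) hc.le).trans hi⟩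
  by_contra hcon
  push Not at hcon
  have hseq : ∀ k : ℕ, ∃ ξ : Fin n → ℝ, ∀ i,
      |MvPolynomial.eval (signedExp σ ξ) (f i)| < 1 / ((k : ℝ) + 1) * s ξ := fun k =>
    hcon _ (by positivity)
  choose ξ hξ using hseq
  let U : Ultrafilter ℕ := hyperfilter ℕ
  have hlim : ∀ α : Fin n → ℝ, ∃ v : ℝ, α ∈ A →
      0 ≤ v ∧ Tendsto (fun k => Real.exp (α ⬝ᵥ ξ k) / s (ξ k)) U (𝓝 v) := by
    intro α
    by_cases hα : α ∈ A
    · obtain ⟨v, hv, h⟩ := exists_tendsto_ultrafilter U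
        (u := fun k => Real.exp (α ⬝ᵥ ξ k) / s (ξ k)) fun k =>
          ⟨div_nonneg (Real.exp_pos _).le (hs0 _).le, (div_le_one (hs0 _)).2 (hle _ α hα)⟩
      exact ⟨v, fun _ => ⟨hv.1, h⟩⟩
    · exact ⟨0, fun h => absurd h hα⟩
  choose v hv using hlim
  have hsum : ∑ α ∈ A, v α = 1 := by
    refine tendsto_nhds_unique (tendsto_finsetSum A fun α hα => (hv α hα).2) ?_
    refine tendsto_const_nhds.congr fun k => ?_
    rw [← Finset.sum_div, div_self (hs0 _).ne']
  obtain ⟨β, hβ, hvβ⟩ : ∃ β ∈ A, 0 < v β := by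
    by_contra hno
    push Not at hno
    linarith [Finset.sum_nonpos hno]
  obtain ⟨η, ζ, hmax, hon, hoff⟩ := exists_face_of_tendsto (l := (U : Filter ℕ))
    (s := fun k => s (ξ k)) (fun k => hs0 _) (fun α hα => (hv α hα).1) (fun α hα => (hv α hα).2)
    hβ hvβ
  have hmem : ∀ {i α}, α ∈ (f i).support → expPoint α ∈ A := fun h =>
    Finset.mem_image_of_mem _ (mem_jointSupport h)
  have hzero : ∀ i, ∑ α ∈ (f i).support,
      (f i).coeff α * (∏ j, σ j ^ α j) * v (expPoint α) = 0 := by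
    intro i
    have h1 : Tendsto (fun k => MvPolynomial.eval (signedExp σ (ξ k)) (f i) / s (ξ k)) U
        (𝓝 (∑ α ∈ (f i).support, (f i).coeff α * (∏ j, σ j ^ α j) * v (expPoint α))) := by
      refine (tendsto_finsetSum _ fun α hα =>
        ((hv _ (hmem hα)).2.const_mul ((f i).coeff α * (∏ j, σ j ^ α j)))).congr fun k => ?_
      rw [eval_signedExp, Finset.sum_div]
      exact Finset.sum_congr rfl fun α _ => by rw [mul_div_assoc]
    have h2 : Tendsto (fun k => MvPolynomial.eval (signedExp σ (ξ k)) (f i) / s (ξ k)) U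
        (𝓝 0) := by
      refine squeeze_zero_norm (a := fun k : ℕ => 1 / ((k : ℝ) + 1)) (fun k => ?_)
        (tendsto_one_div_add_atTop_nhds_zero_nat.mono_left Nat.hyperfilter_le_atTop)
      rw [Real.norm_eq_abs, abs_div, abs_of_pos (hs0 _), div_le_iff₀ (hs0 _)]
      exact (hξ k i).le
    exact tendsto_nhds_unique h1 h2
  set Γ := newtonPolyhedron f with hΓ
  have hΓA : Γ = convexHull ℝ (A : Set (Fin n → ℝ)) := newtonPolyhedron_eq f
  have hΓle : ∀ y ∈ Γ, y ⬝ᵥ η ≤ β ⬝ᵥ η := by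
    intro y hy
    rw [hΓA] at hy
    obtain ⟨μ, hμ, hμ1, rfl⟩ := exists_weights_of_mem_convexHull hy
    rw [sum_smul_dotProduct]
    calc _ ≤ ∑ α ∈ A, μ α * (β ⬝ᵥ η) :=
          Finset.sum_le_sum fun α hα => mul_le_mul_of_nonneg_left (hmax α hα) (hμ α)
      _ = _ := by rw [← Finset.sum_mul, hμ1, one_mul]
  have hAΓ : ∀ α ∈ A, α ∈ Γ := fun α hα => by rw [hΓA]; exact subset_convexHull ℝ _ hα
  let Δ : Set (Fin n → ℝ) := {x ∈ Γ | ∀ y ∈ Γ, y ⬝ᵥ η ≤ x ⬝ᵥ η}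
  have hΔ : IsFace Γ Δ :=
    ⟨⟨β, hAΓ β hβ, hΓle⟩, isExposed_setOf_dotProduct_le Γ η⟩
  have hΔmem : ∀ α ∈ A, α ∈ Δ ↔ α ⬝ᵥ η = β ⬝ᵥ η := fun α hα =>
    ⟨fun h => le_antisymm (hmax α hα) (h.2 β (hAΓ β hβ)),
      fun h => ⟨hAΓ α hα, fun y hy => (hΓle y hy).trans h.ge⟩⟩
  obtain ⟨i, hi⟩ := hf Δ hΔ (signedExp σ ζ) fun j => mul_ne_zero (hσ j) (Real.exp_pos _).ne'
  refine hi ?_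
  rw [facePart, map_sum, Finset.sum_filter]
  refine (Finset.sum_congr rfl fun α hα => (?_ : _ =
    Real.exp (β ⬝ᵥ ζ) / v β * ((f i).coeff α * (∏ j, σ j ^ α j) * v (expPoint α)))).trans ?_
  · have hαA := hmem hα
    by_cases h1 : expPoint α ⬝ᵥ η = β ⬝ᵥ η
    · rw [if_pos ((hΔmem _ hαA).2 h1), eval_monomial_signedExp, hon _ hαA h1]
      ring
    · rw [if_neg (fun h => h1 ((hΔmem _ hαA).1 h)), hoff _ hαA h1, mul_zero, mul_zero]
  · rw [← Finset.mul_sum, hzero, mul_zero]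

/-! ### From logarithmic volumes to sublevel sets -/

theorem logVolume_mono (A : Finset (Fin n → ℝ)) : Monotone (logVolume A) := fun _ _ h =>
  lintegral_mono_set fun _ hξ α hα => (hξ α hα).trans h

theorem exists_logVolume_le_volume_sublevel (f : Fin m → MvPolynomial (Fin n) ℝ) :
    ∃ C : ℝ, 0 < C ∧ ∀ r : ℝ, 0 < r →
      logVolume (exponentPoints f) (Real.log (r / C)) ≤ volume (sublevel f r) := by
  obtain ⟨C, hC, h⟩ := exists_abs_eval_le f
  refine ⟨C, hC, fun r hr => ?_⟩
  rw [logVolume, ← volume_image_signedExp (σ := 1) (fun _ => by simp)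
    (measurableSet_logRegion _ _)]
  refine measure_mono ?_
  rintro _ ⟨ξ, hξ, rfl⟩ i
  refine (h _ ξ hξ i).trans_eq ?_
  rw [Real.exp_log (by positivity)]
  field_simp

theorem MikhailovGindikin.exists_volume_sublevel_le {f : Fin m → MvPolynomial (Fin n) ℝ}
    (hf : MikhailovGindikin f) (hne : (exponentPoints f).Nonempty) :
    ∃ c : ℝ, 0 < c ∧ ∀ r : ℝ, 0 < r →
      volume (sublevel f r) ≤ 2 ^ n * logVolume (exponentPoints f) (Real.log (r / c)) := by
  classical
  set Sg : Finset (Fin n → ℝ) := Fintype.piFinset fun _ => {1, -1} with hSg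
  have hSg1 : ∀ σ ∈ Sg, ∀ j, |σ j| = 1 := by
    intro σ hσ j
    have := Fintype.mem_piFinset.1 hσ j
    rcases Finset.mem_insert.1 this with h | h
    · rw [h, abs_one]
    · rw [Finset.mem_singleton.1 h, abs_neg, abs_one]
  have hcard : Sg.card ≤ 2 ^ n := by
    rw [hSg, Fintype.card_piFinset]
    refine (Finset.prod_le_prod' fun _ _ => Finset.card_le_two).trans_eq ?_
    simp
  have hex : ∀ σ : Fin n → ℝ, ∃ c : ℝ, σ ∈ Sg → 0 < c ∧ ∀ ξ : Fin n → ℝ, ∃ i,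
      ∀ α ∈ exponentPoints f,
        c * Real.exp (α ⬝ᵥ ξ) ≤ |MvPolynomial.eval (signedExp σ ξ) (f i)| := by
    intro σ
    by_cases hσ : σ ∈ Sg
    · obtain ⟨c, hc⟩ := hf.exists_le_abs_eval hne (σ := σ) fun j h => by
        have := hSg1 σ hσ j
        simp [h] at this
      exact ⟨c, fun _ => hc⟩
    · exact ⟨0, fun h => absurd h hσ⟩
  choose C hC using hex
  obtain ⟨c, hc, hcC⟩ := exists_pos_le_of_forall_pos Sg C fun σ hσ => (hC σ hσ).1
  refine ⟨c, hc, fun r hr => ?_⟩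
  set D := logRegion (exponentPoints f) (Real.log (r / c)) with hD
  -- Off the coordinate hyperplanes, `σ_j` is the sign of `x_j` and `ξ_j = ln |x_j|`; `Real.log` takes
  -- the absolute value by itself.
  have hcover : sublevel f r ⊆ (⋃ j, {x : Fin n → ℝ | x j = 0}) ∪ ⋃ σ ∈ Sg, signedExp σ '' D := by
    intro x hx
    by_cases h0 : ∃ j, x j = 0
    · exact Or.inl (Set.mem_iUnion.2 h0)
    push Not at h0
    right
    set σ : Fin n → ℝ := fun j => if 0 < x j then 1 else -1 with hσ
    have hσS : σ ∈ Sg := Fintype.mem_piFinset.2 fun j => by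
      simp only [hσ]; split_ifs <;> simp
    have hxσ : signedExp σ (fun j => Real.log (x j)) = x := by
      ext j
      simp only [signedExp, hσ, Real.exp_log_eq_abs (h0 j)]
      split_ifs with h
      · rw [abs_of_pos h, one_mul]
      · rw [abs_of_nonpos (not_lt.1 h)]; ring
    refine Set.mem_iUnion₂.2 ⟨σ, hσS, _, fun α hα => ?_, hxσ⟩
    obtain ⟨i, hi⟩ := (hC σ hσS).2 fun j => Real.log (x j)
    have h1 := hi α hα
    rw [hxσ] at h1
    have h2 : c * Real.exp (α ⬝ᵥ fun j => Real.log (x j)) ≤ r :=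
      (mul_le_mul_of_nonneg_right (hcC σ hσS) (Real.exp_pos _).le).trans (h1.trans (hx i))
    rw [Real.le_log_iff_exp_le (by positivity), le_div_iff₀ hc, mul_comm]
    exact h2
  have hnull : volume (⋃ j, {x : Fin n → ℝ | x j = 0}) = 0 :=
    measure_iUnion_null fun j => by
      rw [volume_pi]; exact Measure.pi_hyperplane (α := fun _ : Fin n => ℝ) (fun _ => volume) j 0
  calc volume (sublevel f r)
      ≤ volume (⋃ j, {x : Fin n → ℝ | x j = 0}) + volume (⋃ σ ∈ Sg, signedExp σ '' D) :=
        (measure_mono hcover).trans (measure_union_le _ _)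
    _ = volume (⋃ σ ∈ Sg, signedExp σ '' D) := by rw [hnull, zero_add]
    _ ≤ ∑ σ ∈ Sg, volume (signedExp σ '' D) := measure_biUnion_finset_le _ _
    _ = ∑ _σ ∈ Sg, logVolume (exponentPoints f) (Real.log (r / c)) :=
        Finset.sum_congr rfl fun σ hσ =>
          volume_image_signedExp (hSg1 σ hσ) (measurableSet_logRegion _ _)
    _ ≤ 2 ^ n * logVolume (exponentPoints f) (Real.log (r / c)) := by
        rw [Finset.sum_const, nsmul_eq_mul]
        gcongr
        exact_mod_cast hcard

theorem exists_isFarthestDiag (hn : 0 < n) {A : Finset (Fin n → ℝ)}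
    (h : diag n 1 ∈ coneOf (convexHull ℝ (A : Set (Fin n → ℝ)))) :
    ∃ d, IsFarthestDiag (convexHull ℝ (A : Set (Fin n → ℝ))) d := by
  set j₀ : Fin n := ⟨0, hn⟩
  set Γ := convexHull ℝ (A : Set (Fin n → ℝ)) with hΓ
  have hΓc : IsCompact Γ := Set.Finite.isCompact_convexHull ℝ A.finite_toSet
  obtain ⟨c, hc, x, hx, hcx⟩ := h
  have hc0 : c ≠ 0 := by
    rintro rfl
    have := congrFun hcx j₀
    simp [diag] at this
  have hxd : diag n c⁻¹ = x := by
    ext j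
    have := congrFun hcx j
    simp only [diag, Pi.smul_apply, smul_eq_mul] at this ⊢
    field_simp
    linarith
  have hcl : IsClosed {x : Fin n → ℝ | ∀ j, x j = x j₀} := by
    simp only [Set.ofPred_forall]
    exact isClosed_iInter fun j => isClosed_eq (continuous_apply j) (continuous_apply j₀)
  obtain ⟨y, ⟨hyΓ, hy⟩, hmax⟩ := (hΓc.inter_right hcl).exists_isMaxOn
    ⟨x, hx, fun j => by rw [← hxd]; rfl⟩ (continuous_apply j₀).continuousOn
  have hyd : diag n (y j₀) = y := funext fun j => (hy j).symm
  have hge : ∀ t, diag n t ∈ Γ → t ≤ y j₀ := fun t ht => hmax ⟨ht, fun j => rfl⟩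
  refine ⟨y j₀, ⟨?_, by rw [hyd]; exact hyΓ⟩, fun t ht => hge t ht.2⟩
  exact lt_of_lt_of_le (inv_pos.2 (lt_of_le_of_ne hc hc0.symm)) (hge _ (by rw [hxd]; exact hx))

theorem eventually_log_div_bounds {c : ℝ} (hc : 0 < c) (R₀ : ℝ) :
    ∀ᶠ r in atTop, 0 < r ∧ R₀ ≤ Real.log (r / c) ∧ 0 ≤ Real.log r ∧
      1 / 2 * Real.log r ≤ Real.log (r / c) ∧ Real.log (r / c) ≤ 2 * Real.log r := by
  filter_upwards [eventually_gt_atTop 0, Real.tendsto_log_atTop.eventually_ge_atTop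
    (2 * |Real.log c| + 2 * |R₀|)] with r hr hlog
  have h1 := abs_le.1 (le_refl |Real.log c|)
  have h2 := le_abs_self R₀
  have h3 := abs_nonneg R₀
  have h4 := abs_nonneg (Real.log c)
  rw [Real.log_div hr.ne' hc.ne']
  refine ⟨hr, ?_, ?_, ?_, ?_⟩ <;> linarith

theorem exp_log_div_mul {r c : ℝ} (hr : 0 < r) (hc : 0 < c) (θ : ℝ) :
    Real.exp (Real.log (r / c) * θ) = r ^ θ / c ^ θ := by
  rw [← Real.div_rpow hr.le hc.le, Real.rpow_def_of_pos (div_pos hr hc)]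

theorem volume_sublevel_eq_top (hn : 0 < n) (f : Fin m → MvPolynomial (Fin n) ℝ)
    (h : diag n 1 ∉ interior (coneOf (newtonPolyhedron f))) :
    ∃ r : ℝ, 0 < r ∧ volume (sublevel f r) = ⊤ := by
  rw [newtonPolyhedron_eq] at h
  obtain ⟨η, hη, hA, hsum⟩ : ∃ η : Fin n → ℝ, η ≠ 0 ∧
      (∀ α ∈ exponentPoints f, α ⬝ᵥ η ≤ 0) ∧ 0 ≤ ∑ j, η j := by
    rcases (exponentPoints f).eq_empty_or_nonempty with h0 | hne
    · exact ⟨1, fun h1 => one_ne_zero (congrFun h1 ⟨0, hn⟩), by simp [h0], by simp⟩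
    · exact exists_recession_of_notMem_interior hne h
  obtain ⟨C, hC, hvol⟩ := exists_logVolume_le_volume_sublevel f
  refine ⟨C * Real.exp 1, by positivity, ?_⟩
  have := hvol (C * Real.exp 1) (by positivity)
  rw [mul_div_cancel_left₀ _ hC.ne', Real.log_exp, logVolume_eq_top hη hA hsum one_pos] at this
  exact top_le_iff.1 this

theorem MikhailovGindikin.exists_asympAtTop {f : Fin m → MvPolynomial (Fin n) ℝ}
    (hf : MikhailovGindikin f) (hn : 0 < n)
    (h : diag n 1 ∈ interior (coneOf (newtonPolyhedron f))) :
    (∀ r : ℝ, 0 < r → volume (sublevel f r) < ⊤) ∧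
    ∃ (d : ℝ) (Λ : Set (Fin n → ℝ)),
      IsFarthestDiag (newtonPolyhedron f) d ∧
      IsSmallestFaceAt (newtonPolyhedron f) (diag n d) Λ ∧
      AsympAtTop (fun r => (volume (sublevel f r)).toReal)
        (fun r => r ^ (1 / d) * Real.log r ^ ((n : ℤ) - (affDim Λ : ℤ) - 1)) := by
  rw [newtonPolyhedron_eq] at h ⊢
  obtain ⟨d, hd⟩ := exists_isFarthestDiag hn (interior_subset h)
  have hd0 : 0 < d := hd.1.1
  obtain ⟨ξ₀, w, hw⟩ := exists_strictly_complementary hn hd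
  have hne : (exponentPoints f).Nonempty := hw.filter_nonempty.mono (Finset.filter_subset _ _)
  obtain ⟨b, I, hIcard, hIb, hrepr⟩ := exists_basis_adapted
    (((exponentPoints f).filter fun α => α ⬝ᵥ ξ₀ = 1 : Finset (Fin n → ℝ)) : Set (Fin n → ℝ))
  obtain ⟨K, hK, hup⟩ := hw.exists_logVolume_le hd0 h hIb
  obtain ⟨k, R₀, hk, hR₀, hlow⟩ := hw.exists_le_logVolume hd0 hIb fun α hα h1 =>
    hrepr α (Submodule.subset_span (Finset.mem_coe.2 (Finset.mem_filter.2 ⟨hα, h1⟩)))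
  obtain ⟨c, hc, hvup⟩ := hf.exists_volume_sublevel_le hne
  obtain ⟨C, hC, hvlow⟩ := exists_logVolume_le_volume_sublevel f
  have hfin : ∀ r : ℝ, 0 < r → volume (sublevel f r) < ⊤ := by
    intro r hr
    refine (hvup r hr).trans_lt (ENNReal.mul_lt_top (by simp) ?_)
    refine (logVolume_mono _ (le_max_left _ 1)).trans_lt ((hup _ (le_max_right _ _)).trans_lt ?_)
    exact ENNReal.ofReal_lt_top
  refine ⟨hfin, d, _, hd, hw.isSmallestFaceAt, ?_⟩
  set p := (Iᶜ).card with hp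
  have hexp : (n : ℤ) - (affDim {x ∈ convexHull ℝ (exponentPoints f : Set (Fin n → ℝ)) |
      x ⬝ᵥ ξ₀ = 1} : ℤ) - 1 = (p : ℤ) := by
    have h1 := hw.finrank_span_eq
    rw [← hIcard] at h1
    have h2 := Finset.card_add_card_compl I
    rw [Fintype.card_fin] at h2
    omega
  have hθ : ∑ j, ξ₀ j = 1 / d := by
    rw [eq_div_iff hd0.ne', mul_comm]; exact hw.mul_sum_eq_one
  rw [hθ] at hup hlow
  simp only [hexp, zpow_natCast]
  have hcθ : 0 < c ^ (1 / d) := Real.rpow_pos_of_pos hc _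
  have hCθ : 0 < C ^ (1 / d) := Real.rpow_pos_of_pos hC _
  refine ⟨k / C ^ (1 / d) * (1 / 2) ^ p, 2 ^ n * (K / c ^ (1 / d) * 2 ^ p), by positivity,
    by positivity, ?_⟩
  filter_upwards [eventually_log_div_bounds hc 1, eventually_log_div_bounds hC R₀]
    with r ⟨hr, h1, hl0, _, hl2⟩ ⟨_, h3, _, hl4, _⟩
  have hrθ : 0 < r ^ (1 / d) := Real.rpow_pos_of_pos hr _
  constructor
  · have e1 := (hlow _ h3).trans (hvlow r hr)
    rw [ENNReal.ofReal_le_iff_le_toReal (hfin r hr).ne, exp_log_div_mul hr hC] at e1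
    refine le_trans ?_ e1
    calc k / C ^ (1 / d) * (1 / 2) ^ p * (r ^ (1 / d) * Real.log r ^ p)
        = k * (r ^ (1 / d) / C ^ (1 / d) * (1 / 2 * Real.log r) ^ p) := by rw [mul_pow]; ring
      _ ≤ _ := by gcongr
  · have e1 := (hvup r hr).trans (mul_le_mul_right (hup _ h1) _)
    rw [exp_log_div_mul hr hc, show (2 : ENNReal) ^ n = ENNReal.ofReal (2 ^ n) by
      rw [ENNReal.ofReal_pow (by norm_num)]; norm_num, ← ENNReal.ofReal_mul (by positivity)] at e1
    refine (ENNReal.toReal_le_of_le_ofReal (by positivity) e1).trans ?_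
    calc 2 ^ n * (K * (r ^ (1 / d) / c ^ (1 / d) * Real.log (r / c) ^ p))
        ≤ 2 ^ n * (K * (r ^ (1 / d) / c ^ (1 / d) * (2 * Real.log r) ^ p)) := by gcongr
      _ = _ := by rw [mul_pow]; ring

end NewtonVolume

theorem theorem2p2 (n m : ℕ) (hn : 0 < n) (f : Fin m → MvPolynomial (Fin n) ℝ)
    (hf : NewtonVolume.MikhailovGindikin f) :
    ((∀ r : ℝ, 0 < r → volume (NewtonVolume.sublevel f r) < ⊤) ↔
      NewtonVolume.diag n 1 ∈
        interior (NewtonVolume.coneOf (NewtonVolume.newtonPolyhedron f))) ∧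
    ((∀ r : ℝ, 0 < r → volume (NewtonVolume.sublevel f r) < ⊤) →
      ∃ (d : ℝ) (Λ : Set (Fin n → ℝ)),
        NewtonVolume.IsFarthestDiag (NewtonVolume.newtonPolyhedron f) d ∧
        NewtonVolume.IsSmallestFaceAt (NewtonVolume.newtonPolyhedron f)
          (NewtonVolume.diag n d) Λ ∧
        NewtonVolume.AsympAtTop
          (fun r => (volume (NewtonVolume.sublevel f r)).toReal)
          (fun r => r ^ (1 / d) *
            Real.log r ^ ((n : ℤ) - (NewtonVolume.affDim Λ : ℤ) - 1))) := by
  have hmem : (∀ r : ℝ, 0 < r → volume (NewtonVolume.sublevel f r) < ⊤) →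
      NewtonVolume.diag n 1 ∈
        interior (NewtonVolume.coneOf (NewtonVolume.newtonPolyhedron f)) := by
    intro h
    by_contra hcon
    obtain ⟨r, hr, htop⟩ := NewtonVolume.volume_sublevel_eq_top hn f hcon
    exact (h r hr).ne htop
  exact ⟨⟨hmem, fun h => (hf.exists_asympAtTop hn h).1⟩,
    fun h => (hf.exists_asympAtTop hn (hmem h)).2⟩
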